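/- Conventions. A model category is a category with finite limits and finite colimits, equipped with a (closed) model structure, that is, with classes of cofibrations, fibrations and weak equivalences that satisfy Quillen's axioms. Let $\mathfrak{ModQ}$ be the 2-category whose objects are the model categories, whose 1-morphisms $F : \mathcal{M} \to \mathcal{N}$ are the Quillen adjunctions $F : \mathcal{M} \rightleftarrows \mathcal{N} : F^{\flat}$ (the left adjoint $F$ preserves cofibrations and trivial cofibrations), and whose 2-morphisms $F \to G$ are the natural transformations between the left adjoints. A 1-morphism $F : \mathcal{M} \to \mathcal{N}$ is a *Quillen equivalence* if for every cofibrant $X \in \mathcal{M}$ and every fibrant $Y \in \mathcal{N}$ a morphism $F(X) \to Y$ is a weak equivalence if and only if its adjunct $X \to F^{\flat}(Y)$ is one. A 2-morphism $\tau : F \to G$ between 1-morphisms $\mathcal{M} \to \mathcal{N}$ is a *Quillen homotopy* if $\tau_X : F(X) \to G(X)$ is a weak equivalence for every cofibrant object $X$ of $\mathcal{M}$. For a model category $\mathcal{M}$, the *path model* $\mathcal{C}h(\mathcal{M})$ is the category of arrows of $\mathcal{M}$ with the following model structure. A morphism $f = (f_0, f_1)$ from $x : X_0 \to X_1$ to $y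 : Y_0 \to Y_1$ is * a weak equivalence if $f_0 : X_0 \to Y_0$ is a weak equivalence of $\mathcal{M}$; * a fibration if $f_1 : X_1 \to Y_1$ and the induced morphism $X_0 \to X_1 \times_{Y_1} Y_0$ are fibrations of $\mathcal{M}$; * a cofibration if $f_0$ and $f_1$ are cofibrations of $\mathcal{M}$ and the induced morphism $X_1 \amalg_{X_0} Y_0 \to Y_1$ is a weak equivalence of $\mathcal{M}$. The *cylinder model* of $\mathcal{M}$ is $\mathcal{C}yl(\mathcal{M}) = \mathcal{C}h(\mathcal{M}^{op})^{op}$, where $(-)^{op}$ is the opposite model category. **Statement.** Let $\mathfrak{ModQ}^{\dagger}$ be a full sub-2-category of $\mathfrak{ModQ}$, let $\mathfrak{C}$ be a 2-category (or, more generally, a bicategory), and let $\Phi : \mathfrak{ModQ}^{\dagger} \to \mathfrak{C}$ be a pseudo-functor that sends Quillen equivalences to equivalences of $\mathfrak{C}$. Let $\mathcal{M}, \mathcal{N}$ be objects of $\mathfrak{ModQ}^{\dagger}$ such that $\mathcal{C}yl(\mathcal{M})$ or $\mathcal{C}h(\mathcal{N})$ belongs to $\mathfrak{ModQ}^{\dagger}$.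 Then the functor $$\Phi_{\mathcal{M},\mathcal{N}} : \mathfrak{ModQ}^{\dagger}(\mathcal{M},\mathcal{N}) \longrightarrow \mathfrak{C}(\Phi(\mathcal{M}),\Phi(\mathcal{N}))$$ sends Quillen homotopies to isomorphisms: for all 1-morphisms $F, G : \mathcal{M} \to \mathcal{N}$ and every Quillen homotopy $\tau : F \to G$, the 2-morphism $\Phi_{\mathcal{M},\mathcal{N}}(\tau)$ is invertible. -/

import Mathlib

open CategoryTheory CategoryTheory.Limits HomotopicalAlgebra

universe w₂ v₂ u₂ v u

namespace PathModel

section Square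

attribute [local simp] pullback.lift_fst pullback.lift_snd pushout.inl_desc pushout.inr_desc
  pullback.lift_fst_assoc pullback.lift_snd_assoc pushout.inl_desc_assoc pushout.inr_desc_assoc

variable {C : Type u} [Category.{v} C]

section

variable [HasPullbacks C] {X₀ X₁ Y₀ Y₁ : C} {x : X₀ ⟶ X₁} {y : Y₀ ⟶ Y₁} {f₀ : X₀ ⟶ Y₀}
  {f₁ : X₁ ⟶ Y₁} (w : f₀ ≫ y = x ≫ f₁)

/-- The comparison map `X₀ ⟶ Y₀ ×_{Y₁} X₁` of a commutative square. -/
noncomputable def toPullback : X₀ ⟶ pullback y f₁ := pullback.lift f₀ x w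

@[simp]
lemma toPullback_fst : toPullback w ≫ pullback.fst _ _ = f₀ := pullback.lift_fst _ _ _

@[simp]
lemma toPullback_fst_assoc {Z : C} (h : Y₀ ⟶ Z) :
    toPullback w ≫ pullback.fst _ _ ≫ h = f₀ ≫ h := by
  rw [← Category.assoc, toPullback_fst]

@[simp]
lemma toPullback_snd : toPullback w ≫ pullback.snd _ _ = x := pullback.lift_snd _ _ _

@[simp]
lemma toPullback_snd_assoc {Z : C} (h : X₁ ⟶ Z) :
    toPullback w ≫ pullback.snd _ _ ≫ h = x ≫ h := by
  rw [← Category.assoc, toPullback_snd]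

end

section

variable [HasPushouts C] {X₀ X₁ Y₀ Y₁ : C} {x : X₀ ⟶ X₁} {y : Y₀ ⟶ Y₁} {f₀ : X₀ ⟶ Y₀}
  {f₁ : X₁ ⟶ Y₁} (w : f₀ ≫ y = x ≫ f₁)

/-- The comparison map `X₁ ⨿_{X₀} Y₀ ⟶ Y₁` of a commutative square. -/
noncomputable def fromPushout : pushout x f₀ ⟶ Y₁ := pushout.desc f₁ y w.symm

@[simp]
lemma inl_fromPushout : pushout.inl _ _ ≫ fromPushout w = f₁ := pushout.inl_desc _ _ _

@[simp]
lemma inl_fromPushout_assoc {Z : C} (h : Y₁ ⟶ Z) :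
    pushout.inl _ _ ≫ fromPushout w ≫ h = f₁ ≫ h := by
  rw [← Category.assoc, inl_fromPushout]

@[simp]
lemma inr_fromPushout : pushout.inr _ _ ≫ fromPushout w = y := pushout.inr_desc _ _ _

@[simp]
lemma inr_fromPushout_assoc {Z : C} (h : Y₁ ⟶ Z) :
    pushout.inr _ _ ≫ fromPushout w ≫ h = y ≫ h := by
  rw [← Category.assoc, inr_fromPushout]

end

section Retract

variable {X₀ X₁ Y₀ Y₁ : C} {x : X₀ ⟶ X₁} {y : Y₀ ⟶ Y₁} {f₀ : X₀ ⟶ Y₀}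
  {f₁ : X₁ ⟶ Y₁} (w : f₀ ≫ y = x ≫ f₁)
  {X₀' X₁' Y₀' Y₁' : C} {x' : X₀' ⟶ X₁'} {y' : Y₀' ⟶ Y₁'} {f₀' : X₀' ⟶ Y₀'}
  {f₁' : X₁' ⟶ Y₁'} (w' : f₀' ≫ y' = x' ≫ f₁')
  {i₀ : X₀ ⟶ X₀'} {r₀ : X₀' ⟶ X₀} {i₁ : X₁ ⟶ X₁'} {r₁ : X₁' ⟶ X₁}
  {j₀ : Y₀ ⟶ Y₀'} {s₀ : Y₀' ⟶ Y₀} {j₁ : Y₁ ⟶ Y₁'} {s₁ : Y₁' ⟶ Y₁}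

noncomputable def retractToPullback [HasPullbacks C]
    (hX₀ : i₀ ≫ r₀ = 𝟙 _) (hX₁ : i₁ ≫ r₁ = 𝟙 _) (hY₀ : j₀ ≫ s₀ = 𝟙 _)
    (ex : i₀ ≫ x' = x ≫ i₁) (ey : j₀ ≫ y' = y ≫ j₁)
    (rx : r₀ ≫ x = x' ≫ r₁) (ry : s₀ ≫ y = y' ≫ s₁)
    (e₀ : i₀ ≫ f₀' = f₀ ≫ j₀) (e₁ : i₁ ≫ f₁' = f₁ ≫ j₁)
    (t₀ : r₀ ≫ f₀ = f₀' ≫ s₀) (t₁ : r₁ ≫ f₁ = f₁' ≫ s₁) :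
    RetractArrow (toPullback w) (toPullback w') where
  i := Arrow.homMk' i₀ (pullback.map _ _ _ _ j₀ i₁ j₁ ey.symm e₁.symm) (by
    apply pullback.hom_ext <;> simp [e₀, ex])
  r := Arrow.homMk' r₀ (pullback.map _ _ _ _ s₀ r₁ s₁ ry.symm t₁.symm) (by
    apply pullback.hom_ext <;> simp [t₀, rx])
  retract := by
    apply Arrow.hom_ext
    · exact hX₀
    · have h : pullback.map y f₁ y' f₁' j₀ i₁ j₁ ey.symm e₁.symm ≫
          pullback.map y' f₁' y f₁ s₀ r₁ s₁ ry.symm t₁.symm = 𝟙 _ := by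
        apply pullback.hom_ext <;> simp [hY₀, hX₁]
      exact h

noncomputable def retractFromPushout [HasPushouts C]
    (hX₁ : i₁ ≫ r₁ = 𝟙 _) (hY₀ : j₀ ≫ s₀ = 𝟙 _) (hY₁ : j₁ ≫ s₁ = 𝟙 _)
    (ex : i₀ ≫ x' = x ≫ i₁) (ey : j₀ ≫ y' = y ≫ j₁)
    (rx : r₀ ≫ x = x' ≫ r₁) (ry : s₀ ≫ y = y' ≫ s₁)
    (e₀ : i₀ ≫ f₀' = f₀ ≫ j₀) (e₁ : i₁ ≫ f₁' = f₁ ≫ j₁)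
    (t₀ : r₀ ≫ f₀ = f₀' ≫ s₀) (t₁ : r₁ ≫ f₁ = f₁' ≫ s₁) :
    RetractArrow (fromPushout w) (fromPushout w') where
  i := Arrow.homMk' (pushout.map _ _ _ _ i₁ j₀ i₀ ex.symm e₀.symm) j₁ (by
    apply pushout.hom_ext <;> simp [e₁, ey])
  r := Arrow.homMk' (pushout.map _ _ _ _ r₁ s₀ r₀ rx.symm t₀.symm) s₁ (by
    apply pushout.hom_ext <;> simp [t₁, ry])
  retract := by
    apply Arrow.hom_ext
    · have h : pushout.map x f₀ x' f₀' i₁ j₀ i₀ ex.symm e₀.symm ≫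
          pushout.map x' f₀' x f₀ r₁ s₀ r₀ rx.symm t₀.symm = 𝟙 _ := by
        apply pushout.hom_ext <;> simp [reassoc_of% hY₀, reassoc_of% hX₁]
      exact h
    · exact hY₁

end Retract

variable [ModelCategory C]

lemma fibration_of_toPullback {X₀ X₁ Y₀ Y₁ : C} {x : X₀ ⟶ X₁} {y : Y₀ ⟶ Y₁} {f₀ : X₀ ⟶ Y₀}
    {f₁ : X₁ ⟶ Y₁} (w : f₀ ≫ y = x ≫ f₁) [Fibration f₁] [Fibration (toPullback w)] :
    Fibration f₀ := by
  rw [← toPullback_fst w]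
  infer_instance

lemma weakEquivalence_of_fromPushout {X₀ X₁ Y₀ Y₁ : C} {x : X₀ ⟶ X₁} {y : Y₀ ⟶ Y₁}
    {f₀ : X₀ ⟶ Y₀} {f₁ : X₁ ⟶ Y₁} (w : f₀ ≫ y = x ≫ f₁) [Cofibration f₀] [WeakEquivalence f₀]
    [WeakEquivalence (fromPushout w)] : WeakEquivalence f₁ := by
  rw [← inl_fromPushout w]
  infer_instance

/-- The lifting property for a cube, in the case where the map on the left is a levelwise
trivial cofibration and the map on the right an injective fibration. -/
lemma exists_lift₁ {A₀ A₁ B₀ B₁ X₀ X₁ Y₀ Y₁ : C} {a : A₀ ⟶ A₁} {b : B₀ ⟶ B₁}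
    {x : X₀ ⟶ X₁} {y : Y₀ ⟶ Y₁} {i₀ : A₀ ⟶ B₀} {i₁ : A₁ ⟶ B₁} {p₀ : X₀ ⟶ Y₀} {p₁ : X₁ ⟶ Y₁}
    {f₀ : A₀ ⟶ X₀} {f₁ : A₁ ⟶ X₁} {g₀ : B₀ ⟶ Y₀} {g₁ : B₁ ⟶ Y₁}
    (wi : i₀ ≫ b = a ≫ i₁) (wp : p₀ ≫ y = x ≫ p₁) (wf : f₀ ≫ x = a ≫ f₁)
    (wg : g₀ ≫ y = b ≫ g₁) (w₀ : f₀ ≫ p₀ = i₀ ≫ g₀) (w₁ : f₁ ≫ p₁ = i₁ ≫ g₁)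
    [Cofibration i₀] [WeakEquivalence i₀] [Cofibration i₁] [WeakEquivalence i₁]
    [Fibration p₁] [Fibration (toPullback wp)] :
    ∃ (l₀ : B₀ ⟶ X₀) (l₁ : B₁ ⟶ X₁), l₀ ≫ x = b ≫ l₁ ∧ i₀ ≫ l₀ = f₀ ∧ l₀ ≫ p₀ = g₀ ∧
      i₁ ≫ l₁ = f₁ ∧ l₁ ≫ p₁ = g₁ := by
  have sq₁ : CommSq f₁ i₁ p₁ g₁ := ⟨w₁⟩
  have sq₀ : CommSq f₀ i₀ (toPullback wp) (pullback.lift g₀ (b ≫ sq₁.lift) (by simp [wg])) := ⟨by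
    apply pullback.hom_ext
    · simp [w₀]
    · simp [wf, reassoc_of% wi]⟩
  obtain ⟨l, hl, hl'⟩ : ∃ l : B₀ ⟶ X₀, i₀ ≫ l = f₀ ∧ l ≫ toPullback wp = _ :=
    ⟨sq₀.lift, sq₀.fac_left, sq₀.fac_right⟩
  refine ⟨l, sq₁.lift, ?_, hl, ?_, by simp, by simp⟩
  · simpa using hl' =≫ pullback.snd _ _
  · simpa using hl' =≫ pullback.fst _ _

/-- The lifting property for a cube, in the case where the map on the left is a cofibration
and the map on the right a trivial fibration of the path model. -/
lemma exists_lift₂ {A₀ A₁ B₀ B₁ X₀ X₁ Y₀ Y₁ : C} {a : A₀ ⟶ A₁} {b : B₀ ⟶ B₁}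
    {x : X₀ ⟶ X₁} {y : Y₀ ⟶ Y₁} {i₀ : A₀ ⟶ B₀} {i₁ : A₁ ⟶ B₁} {p₀ : X₀ ⟶ Y₀} {p₁ : X₁ ⟶ Y₁}
    {f₀ : A₀ ⟶ X₀} {f₁ : A₁ ⟶ X₁} {g₀ : B₀ ⟶ Y₀} {g₁ : B₁ ⟶ Y₁}
    (wi : i₀ ≫ b = a ≫ i₁) (wp : p₀ ≫ y = x ≫ p₁) (wf : f₀ ≫ x = a ≫ f₁)
    (wg : g₀ ≫ y = b ≫ g₁) (w₀ : f₀ ≫ p₀ = i₀ ≫ g₀) (w₁ : f₁ ≫ p₁ = i₁ ≫ g₁)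
    [Cofibration i₀] [Cofibration i₁] [WeakEquivalence (fromPushout wi)]
    [Fibration p₁] [Fibration (toPullback wp)] [WeakEquivalence p₀] :
    ∃ (l₀ : B₀ ⟶ X₀) (l₁ : B₁ ⟶ X₁), l₀ ≫ x = b ≫ l₁ ∧ i₀ ≫ l₀ = f₀ ∧ l₀ ≫ p₀ = g₀ ∧
      i₁ ≫ l₁ = f₁ ∧ l₁ ≫ p₁ = g₁ := by
  have : Fibration p₀ := fibration_of_toPullback wp
  -- a first lift at level `0`
  have sq : CommSq f₀ i₀ p₀ g₀ := ⟨w₀⟩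
  obtain ⟨k, hk, hk'⟩ : ∃ k : B₀ ⟶ X₀, i₀ ≫ k = f₀ ∧ k ≫ p₀ = g₀ :=
    ⟨sq.lift, by simp, by simp⟩
  -- factor the comparison map and extend to the intermediate object
  let hE := MorphismProperty.factorizationData (trivialCofibrations C) (fibrations C)
    (fromPushout wi)
  have : WeakEquivalence hE.p := weakEquivalence_of_precomp_of_fac hE.fac
  have sqE : CommSq (pushout.desc f₁ (k ≫ x) (by rw [← wf, reassoc_of% hk])) hE.i p₁
      (hE.p ≫ g₁) := ⟨by
    apply pushout.hom_ext
    · simp [w₁]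
    · simp [← wg, ← hk', wp]⟩
  obtain ⟨e, he, he'⟩ : ∃ e : hE.Z ⟶ X₁, hE.i ≫ e = pushout.desc f₁ (k ≫ x)
      (by rw [← wf, reassoc_of% hk]) ∧ e ≫ p₁ = hE.p ≫ g₁ := ⟨sqE.lift, by simp, by simp⟩
  have sqS : CommSq (pushout.inl a i₀ ≫ hE.i) i₁ hE.p (𝟙 B₁) := ⟨by simp⟩
  obtain ⟨s, hs, hs'⟩ : ∃ s : B₁ ⟶ hE.Z, i₁ ≫ s = pushout.inl a i₀ ≫ hE.i ∧ s ≫ hE.p = 𝟙 _ :=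
    ⟨sqS.lift, by simp, by simp⟩
  -- a relative cylinder
  let hQ := MorphismProperty.factorizationData (cofibrations C) (trivialFibrations C)
    (pushout.desc (𝟙 B₀) (𝟙 B₀) (rfl : i₀ ≫ 𝟙 B₀ = i₀ ≫ 𝟙 B₀))
  let c₀ : B₀ ⟶ hQ.Z := pushout.inl i₀ i₀ ≫ hQ.i
  let c₁ : B₀ ⟶ hQ.Z := pushout.inr i₀ i₀ ≫ hQ.i
  have hc₀ : c₀ ≫ hQ.p = 𝟙 _ := by simp [c₀]
  have hc₁ : c₁ ≫ hQ.p = 𝟙 _ := by simp [c₁]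
  have hc : i₀ ≫ c₀ = i₀ ≫ c₁ := by simp [c₀, c₁, pushout.condition_assoc]
  have : Cofibration c₀ := by dsimp [c₀]; infer_instance
  have : WeakEquivalence c₀ := weakEquivalence_of_postcomp_of_fac hc₀
  have sqK : CommSq (pushout.desc (pushout.inr a i₀ ≫ hE.i) (b ≫ s) (by
      rw [reassoc_of% wi, hs, pushout.condition_assoc])) hQ.i hE.p (hQ.p ≫ b) := ⟨by
    apply pushout.hom_ext
    · simp
    · simp [hs']⟩
  obtain ⟨K, hK, hK'⟩ : ∃ K : hQ.Z ⟶ hE.Z, hQ.i ≫ K = pushout.desc (pushout.inr a i₀ ≫ hE.i)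
      (b ≫ s) (by rw [reassoc_of% wi, hs, pushout.condition_assoc]) ∧ K ≫ hE.p = hQ.p ≫ b :=
    ⟨sqK.lift, by simp, by simp⟩
  have hK₀ : c₀ ≫ K = pushout.inr a i₀ ≫ hE.i := by simp [c₀, hK]
  have hK₁ : c₁ ≫ K = b ≫ s := by simp [c₁, hK]
  -- deform the first lift along the cylinder
  have sqL : CommSq k c₀ (toPullback wp) (pullback.lift (hQ.p ≫ g₀) (K ≫ e) (by
      simp [he', reassoc_of% hK', wg])) := ⟨by
    apply pullback.hom_ext
    · simp [hk', reassoc_of% hc₀]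
    · simp [reassoc_of% hK₀, he]⟩
  obtain ⟨L, hL, hL'⟩ : ∃ L : hQ.Z ⟶ X₀, c₀ ≫ L = k ∧ L ≫ toPullback wp = _ :=
    ⟨sqL.lift, sqL.fac_left, sqL.fac_right⟩
  have hL₀ : L ≫ p₀ = hQ.p ≫ g₀ := by simpa using hL' =≫ pullback.fst _ _
  have hL₁ : L ≫ x = K ≫ e := by simpa using hL' =≫ pullback.snd _ _
  refine ⟨c₁ ≫ L, s ≫ e, ?_, ?_, ?_, ?_, ?_⟩
  · simp [hL₁, reassoc_of% hK₁]
  · rw [← reassoc_of% hc, hL, hk]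
  · simp [hL₀, reassoc_of% hc₁]
  · simp [reassoc_of% hs, he]
  · simp [he', reassoc_of% hs']

/-- The factorization "trivial cofibration, fibration" of the path model. -/
lemma exists_fac₁ {X₀ X₁ Y₀ Y₁ : C} {x : X₀ ⟶ X₁} {y : Y₀ ⟶ Y₁} {f₀ : X₀ ⟶ Y₀}
    {f₁ : X₁ ⟶ Y₁} (w : f₀ ≫ y = x ≫ f₁) :
    ∃ (E₀ E₁ : C) (e : E₀ ⟶ E₁) (i₀ : X₀ ⟶ E₀) (i₁ : X₁ ⟶ E₁) (p₀ : E₀ ⟶ Y₀) (p₁ : E₁ ⟶ Y₁)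
      (wi : i₀ ≫ e = x ≫ i₁) (wp : p₀ ≫ y = e ≫ p₁), i₀ ≫ p₀ = f₀ ∧ i₁ ≫ p₁ = f₁ ∧
      Cofibration i₀ ∧ Cofibration i₁ ∧ WeakEquivalence (fromPushout wi) ∧ WeakEquivalence i₀ ∧
      Fibration p₁ ∧ Fibration (toPullback wp) := by
  let h₁ := MorphismProperty.factorizationData (trivialCofibrations C) (fibrations C) f₁
  let h₀ := MorphismProperty.factorizationData (trivialCofibrations C) (fibrations C)
    (pullback.lift f₀ (x ≫ h₁.i) (by simp [w]) : X₀ ⟶ pullback y h₁.p)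
  have wi : h₀.i ≫ (h₀.p ≫ pullback.snd _ _) = x ≫ h₁.i := by simp
  have wp : (h₀.p ≫ pullback.fst _ _) ≫ y = (h₀.p ≫ pullback.snd _ _) ≫ h₁.p := by
    simp [pullback.condition]
  have hp : toPullback wp = h₀.p := by apply pullback.hom_ext <;> simp
  have hi : WeakEquivalence (pushout.inl _ _ ≫ fromPushout wi) := by
    rw [inl_fromPushout]; infer_instance
  refine ⟨h₀.Z, h₁.Z, h₀.p ≫ pullback.snd _ _, h₀.i, h₁.i, h₀.p ≫ pullback.fst _ _, h₁.p,
    wi, wp, by simp, by simp, inferInstance, inferInstance, ?_, inferInstance, inferInstance, ?_⟩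
  · exact weakEquivalence_of_precomp (pushout.inl _ _) _
  · rw [hp]; infer_instance

/-- The factorization "cofibration, trivial fibration" of the path model. -/
lemma exists_fac₂ {X₀ X₁ Y₀ Y₁ : C} {x : X₀ ⟶ X₁} {y : Y₀ ⟶ Y₁} {f₀ : X₀ ⟶ Y₀}
    {f₁ : X₁ ⟶ Y₁} (w : f₀ ≫ y = x ≫ f₁) :
    ∃ (E₀ E₁ : C) (e : E₀ ⟶ E₁) (i₀ : X₀ ⟶ E₀) (i₁ : X₁ ⟶ E₁) (p₀ : E₀ ⟶ Y₀) (p₁ : E₁ ⟶ Y₁)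
      (wi : i₀ ≫ e = x ≫ i₁) (wp : p₀ ≫ y = e ≫ p₁), i₀ ≫ p₀ = f₀ ∧ i₁ ≫ p₁ = f₁ ∧
      Cofibration i₀ ∧ Cofibration i₁ ∧ WeakEquivalence (fromPushout wi) ∧ WeakEquivalence p₀ ∧
      Fibration p₁ ∧ Fibration (toPullback wp) := by
  let h := MorphismProperty.factorizationData (cofibrations C) (trivialFibrations C) f₀
  let h₁ := MorphismProperty.factorizationData (trivialCofibrations C) (fibrations C)
    (pushout.desc f₁ (h.p ≫ y) (by simp [w]) : pushout x h.i ⟶ Y₁)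
  let h₀ := MorphismProperty.factorizationData (trivialCofibrations C) (fibrations C)
    (pullback.lift h.p (pushout.inr _ _ ≫ h₁.i) (by simp) : h.Z ⟶ pullback y h₁.p)
  have h₀₁ : h₀.i ≫ h₀.p ≫ pullback.snd _ _ = pushout.inr x h.i ≫ h₁.i := by simp
  have wi : (h.i ≫ h₀.i) ≫ (h₀.p ≫ pullback.snd _ _) = x ≫ pushout.inl x h.i ≫ h₁.i := by
    rw [Category.assoc, h₀₁, pushout.condition_assoc]
  have wp : (h₀.p ≫ pullback.fst _ _) ≫ y = (h₀.p ≫ pullback.snd _ _) ≫ h₁.p := by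
    simp [pullback.condition]
  have hp : toPullback wp = h₀.p := by apply pullback.hom_ext <;> simp
  -- the map between pushouts is a pushout of `h₀.i`
  let t : pushout x h.i ⟶ pushout x (h.i ≫ h₀.i) :=
    pushout.desc (pushout.inl _ _) (h₀.i ≫ pushout.inr _ _) 
      (pushout.condition.trans (Category.assoc _ _ _))
  have ht : IsPushout (pushout.inr x h.i) h₀.i t (pushout.inr x (h.i ≫ h₀.i)) := by
    refine (IsPushout.of_top (h₁₁ := x) (v₁₁ := h.i) (v₁₂ := pushout.inl x h.i) ?_ (by simp [t])
      (IsPushout.of_hasPushout x h.i))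
    simpa [t] using IsPushout.of_hasPushout x (h.i ≫ h₀.i)
  have ht' : WeakEquivalence t := by
    rw [weakEquivalence_iff]
    exact (MorphismProperty.of_isPushout (P := trivialCofibrations C) ht h₀.hi).2
  have hi : WeakEquivalence (t ≫ fromPushout wi) := by
    have : t ≫ fromPushout wi = h₁.i := by
      apply pushout.hom_ext <;> simp [t]
    rw [this]; infer_instance
  have hi' : WeakEquivalence (fromPushout wi) := weakEquivalence_of_precomp t _
  have hp₀ : WeakEquivalence (h₀.i ≫ h₀.p ≫ pullback.fst _ _) := by
    have : h₀.i ≫ h₀.p ≫ pullback.fst _ _ = h.p := by simp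
    rw [this]; infer_instance
  refine ⟨h₀.Z, h₁.Z, h₀.p ≫ pullback.snd _ _, h.i ≫ h₀.i, pushout.inl _ _ ≫ h₁.i,
    h₀.p ≫ pullback.fst _ _, h₁.p, wi, wp, by simp, by simp, inferInstance, inferInstance,
    hi', weakEquivalence_of_precomp h₀.i _, inferInstance, ?_⟩
  rw [hp]; infer_instance

end Square

variable (C : Type u) [Category.{v} C] [ModelCategory C]

/-- The fibrations of `Ch(C)`: the morphisms `f : X ⟶ Y` such that `f₁ : X₁ ⟶ Y₁` and
`X₀ ⟶ Y₀ ×_{Y₁} X₁` are fibrations. -/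
@[reducible] def withFibrations : CategoryWithFibrations (Arrow C) where
  fibrations _ _ f := Fibration f.right ∧ Fibration (toPullback (Arrow.w f))

/-- The weak equivalences of `Ch(C)`: the morphisms `f : X ⟶ Y` such that `f₀ : X₀ ⟶ Y₀` is a
weak equivalence. -/
@[reducible] def withWeakEquivalences : CategoryWithWeakEquivalences (Arrow C) where
  weakEquivalences := (weakEquivalences C).inverseImage Arrow.leftFunc

/-- The cofibrations of `Ch(C)`: the morphisms `f : X ⟶ Y` such that `f₀` and `f₁` are
cofibrations and `X₁ ⨿_{X₀} Y₀ ⟶ Y₁` is a weak equivalence. -/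
@[reducible] def withCofibrations : CategoryWithCofibrations (Arrow C) where
  cofibrations _ _ f :=
    Cofibration f.left ∧ Cofibration f.right ∧ WeakEquivalence (fromPushout (Arrow.w f))

section

attribute [local instance] withFibrations withWeakEquivalences withCofibrations

variable {C}

lemma fibration_iff' {X Y : Arrow C} (f : X ⟶ Y) :
    Fibration f ↔ Fibration f.right ∧ Fibration (toPullback (Arrow.w f)) := fibration_iff f

lemma weakEquivalence_iff' {X Y : Arrow C} (f : X ⟶ Y) :
    WeakEquivalence f ↔ WeakEquivalence f.left :=
  (weakEquivalence_iff f).trans (weakEquivalence_iff f.left).symm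

lemma cofibration_iff' {X Y : Arrow C} (f : X ⟶ Y) :
    Cofibration f ↔
      Cofibration f.left ∧ Cofibration f.right ∧ WeakEquivalence (fromPushout (Arrow.w f)) :=
  cofibration_iff f

variable (C)

lemma hasTwoOutOfThreeProperty : (weakEquivalences (Arrow C)).HasTwoOutOfThreeProperty :=
  inferInstanceAs ((weakEquivalences C).inverseImage Arrow.leftFunc).HasTwoOutOfThreeProperty

lemma isStableUnderRetracts : (weakEquivalences (Arrow C)).IsStableUnderRetracts :=
  inferInstanceAs ((weakEquivalences C).inverseImage Arrow.leftFunc).IsStableUnderRetracts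

/-- The path model `Ch(C)`: the arrow category of `C` with the three classes above is a model
category. -/
@[reducible] def modelCategory : ModelCategory (Arrow C) where
  cm2 := hasTwoOutOfThreeProperty C
  cm3a := isStableUnderRetracts C
  cm3b := ⟨by
    intro X Y Z W f g h hg
    rw [← fibration_iff, fibration_iff'] at hg ⊢
    obtain ⟨h₁, h₂⟩ := hg
    rw [fibration_iff] at h₁ h₂ ⊢
    rw [fibration_iff]
    exact ⟨MorphismProperty.of_retract (h.map Arrow.rightFunc) h₁,
      MorphismProperty.of_retract (retractToPullback (Arrow.w f) (Arrow.w g)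
        (congrArg Arrow.Hom.left h.left.retract) (congrArg Arrow.Hom.right h.left.retract)
        (congrArg Arrow.Hom.left h.right.retract)
        (Arrow.w _) (Arrow.w _) (Arrow.w _) (Arrow.w _)
        (congrArg Arrow.Hom.left h.i_w) (congrArg Arrow.Hom.right h.i_w)
        (congrArg Arrow.Hom.left h.r_w) (congrArg Arrow.Hom.right h.r_w)) h₂⟩⟩
  cm3c := ⟨by
    intro X Y Z W f g h hg
    rw [← cofibration_iff, cofibration_iff'] at hg ⊢
    obtain ⟨h₁, h₂, h₃⟩ := hg
    rw [cofibration_iff] at h₁ h₂ ⊢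
    rw [weakEquivalence_iff] at h₃ ⊢
    rw [cofibration_iff]
    exact ⟨MorphismProperty.of_retract (h.map Arrow.leftFunc) h₁,
      MorphismProperty.of_retract (h.map Arrow.rightFunc) h₂,
      MorphismProperty.of_retract (retractFromPushout (Arrow.w f) (Arrow.w g)
        (congrArg Arrow.Hom.right h.left.retract)
        (congrArg Arrow.Hom.left h.right.retract) (congrArg Arrow.Hom.right h.right.retract)
        (Arrow.w _) (Arrow.w _) (Arrow.w _) (Arrow.w _)
        (congrArg Arrow.Hom.left h.i_w) (congrArg Arrow.Hom.right h.i_w)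
        (congrArg Arrow.Hom.left h.r_w) (congrArg Arrow.Hom.right h.r_w)) h₃⟩⟩
  cm4a {A B X Y} i p _ _ _ := by
    obtain ⟨hi₀, hi₁, hi⟩ := (cofibration_iff' i).1 inferInstance
    have wi₀ := (weakEquivalence_iff' i).1 inferInstance
    obtain ⟨hp₁, hp⟩ := (fibration_iff' p).1 inferInstance
    have wi₁ := weakEquivalence_of_fromPushout (Arrow.w i)
    refine ⟨fun {f g} sq => ?_⟩
    obtain ⟨l₀, l₁, h, h₁, h₂, h₃, h₄⟩ := exists_lift₁ (Arrow.w i) (Arrow.w p) (Arrow.w f)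
      (Arrow.w g) (congrArg Arrow.Hom.left sq.w) (congrArg Arrow.Hom.right sq.w)
    exact ⟨⟨⟨Arrow.homMk l₀ l₁ h, Arrow.hom_ext _ _ h₁ h₃, Arrow.hom_ext _ _ h₂ h₄⟩⟩⟩
  cm4b {A B X Y} i p _ _ _ := by
    obtain ⟨hi₀, hi₁, hi⟩ := (cofibration_iff' i).1 inferInstance
    have wp₀ := (weakEquivalence_iff' p).1 inferInstance
    obtain ⟨hp₁, hp⟩ := (fibration_iff' p).1 inferInstance
    refine ⟨fun {f g} sq => ?_⟩
    obtain ⟨l₀, l₁, h, h₁, h₂, h₃, h₄⟩ := exists_lift₂ (Arrow.w i) (Arrow.w p) (Arrow.w f)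
      (Arrow.w g) (congrArg Arrow.Hom.left sq.w) (congrArg Arrow.Hom.right sq.w)
    exact ⟨⟨⟨Arrow.homMk l₀ l₁ h, Arrow.hom_ext _ _ h₁ h₃, Arrow.hom_ext _ _ h₂ h₄⟩⟩⟩
  cm5a := ⟨fun {X Y} f => by
    obtain ⟨E₀, E₁, e, i₀, i₁, p₀, p₁, wi, wp, h₀, h₁, h₂, h₃, h₄, h₅, h₆, h₇⟩ :=
      exists_fac₁ (Arrow.w f)
    exact ⟨{
      Z := Arrow.mk e
      i := Arrow.homMk i₀ i₁ wi
      p := Arrow.homMk p₀ p₁ wp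
      fac := Arrow.hom_ext _ _ h₀ h₁
      hi := ⟨⟨h₂, h₃, h₄⟩, h₅.mem⟩
      hp := ⟨h₆, h₇⟩ }⟩⟩
  cm5b := ⟨fun {X Y} f => by
    obtain ⟨E₀, E₁, e, i₀, i₁, p₀, p₁, wi, wp, h₀, h₁, h₂, h₃, h₄, h₅, h₆, h₇⟩ :=
      exists_fac₂ (Arrow.w f)
    exact ⟨{
      Z := Arrow.mk e
      i := Arrow.homMk i₀ i₁ wi
      p := Arrow.homMk p₀ p₁ wp
      fac := Arrow.hom_ext _ _ h₀ h₁
      hi := ⟨h₂, h₃, h₄⟩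
      hp := ⟨⟨h₆, h₇⟩, h₅.mem⟩ }⟩⟩

end

end PathModel

/-- A Quillen adjunction between model categories, with its left adjoint, right adjoint and
adjunction. -/
structure QuillenAdjunction (C : Type u) [Category.{v} C] [ModelCategory C]
    (D : Type u) [Category.{v} D] [ModelCategory D] where
  /-- the left adjoint -/
  left : C ⥤ D
  /-- the right adjoint -/
  right : D ⥤ C
  /-- the adjunction -/
  adj : left ⊣ right
  map_cofibration {X Y : C} (f : X ⟶ Y) : Cofibration f → Cofibration (left.map f)
  map_weakEquivalence {X Y : C} (f : X ⟶ Y) :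
    Cofibration f → WeakEquivalence f → WeakEquivalence (left.map f)

namespace QuillenAdjunction

section

variable {C : Type u} [Category.{v} C] [ModelCategory C]
  {D : Type u} [Category.{v} D] [ModelCategory D]
  {E : Type u} [Category.{v} E] [ModelCategory E]

variable (C) in
/-- The identity Quillen adjunction. -/
@[simps]
def id : QuillenAdjunction C C where
  left := 𝟭 C
  right := 𝟭 C
  adj := Adjunction.id
  map_cofibration _ h := h
  map_weakEquivalence _ _ h := h

/-- The composition of Quillen adjunctions. -/
@[simps]
def comp (F : QuillenAdjunction C D) (G : QuillenAdjunction D E) : QuillenAdjunction C E where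
  left := F.left ⋙ G.left
  right := G.right ⋙ F.right
  adj := F.adj.comp G.adj
  map_cofibration f h := G.map_cofibration _ (F.map_cofibration f h)
  map_weakEquivalence f h h' :=
    G.map_weakEquivalence _ (F.map_cofibration f h) (F.map_weakEquivalence f h h')

/-- A Quillen equivalence: for `X` cofibrant and `Y` fibrant, a morphism `F X ⟶ Y` is a weak
equivalence if and only if its adjunct `X ⟶ F♭ Y` is a weak equivalence. -/
def IsQuillenEquivalence (F : QuillenAdjunction C D) : Prop :=
  ∀ (X : C) (Y : D), IsCofibrant X → IsFibrant Y → ∀ f : F.left.obj X ⟶ Y,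
    WeakEquivalence f ↔ WeakEquivalence (F.adj.homEquiv X Y f)

/-- A 2-morphism of Quillen adjunctions: a natural transformation of the left adjoints. -/
@[ext]
structure Trans (F G : QuillenAdjunction C D) where
  /-- the natural transformation between the left adjoints -/
  natTrans : F.left ⟶ G.left

@[simps]
instance : Category (QuillenAdjunction C D) where
  Hom F G := Trans F G
  id F := ⟨𝟙 F.left⟩
  comp τ σ := ⟨τ.natTrans ≫ σ.natTrans⟩

@[ext]
lemma trans_ext {F G : QuillenAdjunction C D} {τ σ : F ⟶ G}
    (h : τ.natTrans = σ.natTrans) : τ = σ :=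
  Trans.ext h

/-- A natural isomorphism of left adjoints is an invertible 2-morphism. -/
@[simps]
def isoMk {F G : QuillenAdjunction C D} (e : F.left ≅ G.left) : F ≅ G where
  hom := ⟨e.hom⟩
  inv := ⟨e.inv⟩

/-- A Quillen homotopy: a 2-morphism `τ : F ⟶ G` such that `τ_X : F X ⟶ G X` is a weak
equivalence for every cofibrant object `X`. -/
def IsQuillenHomotopy {F G : QuillenAdjunction C D} (τ : F ⟶ G) : Prop :=
  ∀ X : C, IsCofibrant X → WeakEquivalence (τ.natTrans.app X)

end

end QuillenAdjunction

/-- The objects of the 2-category of model categories. -/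
structure ModQ where
  /-- the underlying type of objects -/
  carrier : Type u
  [category : Category.{v} carrier]
  [modelCategory : ModelCategory carrier]

namespace ModQ

attribute [instance] ModQ.category ModQ.modelCategory

/-- The 2-category of model categories: the 1-morphisms are the Quillen adjunctions, in the
direction of the left adjoint, and the 2-morphisms are the natural transformations between left
adjoints. -/
instance : Bicategory ModQ.{v, u} where
  Hom M N := QuillenAdjunction M.carrier N.carrier
  id M := QuillenAdjunction.id M.carrier
  comp F G := F.comp G
  homCategory _ _ := inferInstance
  whiskerLeft F _ _ τ := ⟨Functor.whiskerLeft F.left τ.natTrans⟩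
  whiskerRight τ G := ⟨Functor.whiskerRight τ.natTrans G.left⟩
  associator F G H := QuillenAdjunction.isoMk (Functor.associator F.left G.left H.left)
  leftUnitor F := QuillenAdjunction.isoMk F.left.leftUnitor
  rightUnitor F := QuillenAdjunction.isoMk F.left.rightUnitor
  whiskerLeft_id F G := QuillenAdjunction.Trans.ext (Functor.whiskerLeft_id' F.left)
  whiskerLeft_comp F _ _ _ τ σ :=
    QuillenAdjunction.Trans.ext (Functor.whiskerLeft_comp F.left τ.natTrans σ.natTrans)
  id_whiskerLeft τ := QuillenAdjunction.Trans.ext (NatTrans.ext (funext fun X =>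
    (by simp : τ.natTrans.app X = 𝟙 _ ≫ τ.natTrans.app X ≫ 𝟙 _)))
  comp_whiskerLeft F G _ _ τ := QuillenAdjunction.Trans.ext (NatTrans.ext (funext fun X =>
    (by simp : τ.natTrans.app (G.left.obj (F.left.obj X)) =
      𝟙 _ ≫ τ.natTrans.app (G.left.obj (F.left.obj X)) ≫ 𝟙 _)))
  id_whiskerRight F G := QuillenAdjunction.Trans.ext (Functor.whiskerRight_id' G.left)
  comp_whiskerRight τ σ G :=
    QuillenAdjunction.Trans.ext (Functor.whiskerRight_comp τ.natTrans σ.natTrans G.left)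
  whiskerRight_id τ := QuillenAdjunction.Trans.ext (NatTrans.ext (funext fun X =>
    (by simp : τ.natTrans.app X = 𝟙 _ ≫ τ.natTrans.app X ≫ 𝟙 _)))
  whiskerRight_comp τ G H := QuillenAdjunction.Trans.ext (NatTrans.ext (funext fun X =>
    (by simp : H.left.map (G.left.map (τ.natTrans.app X)) =
      𝟙 _ ≫ H.left.map (G.left.map (τ.natTrans.app X)) ≫ 𝟙 _)))
  whisker_assoc F _ _ τ H := QuillenAdjunction.Trans.ext (NatTrans.ext (funext fun X =>
    (by simp : H.left.map (τ.natTrans.app (F.left.obj X)) =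
      𝟙 _ ≫ H.left.map (τ.natTrans.app (F.left.obj X)) ≫ 𝟙 _)))
  whisker_exchange τ σ := QuillenAdjunction.Trans.ext (NatTrans.ext (funext fun X =>
    (σ.natTrans.naturality (τ.natTrans.app X)).symm))
  pentagon F G H I := QuillenAdjunction.Trans.ext (NatTrans.ext (funext fun X =>
    (by simp : I.left.map (𝟙 (H.left.obj (G.left.obj (F.left.obj X)))) ≫ 𝟙 _ ≫ 𝟙 _ =
      𝟙 _ ≫ 𝟙 _)))
  triangle F G := QuillenAdjunction.Trans.ext (NatTrans.ext (funext fun X =>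
    (by simp : 𝟙 _ ≫ 𝟙 _ = G.left.map (𝟙 (F.left.obj X)))))

/-- The opposite model category. -/
def op (M : ModQ.{v, u}) : ModQ.{v, u} where
  carrier := M.carrierᵒᵖ

/-- The path model `Ch(M)` of a model category `M`. -/
def path (M : ModQ.{v, u}) : ModQ.{v, max u v} where
  carrier := Arrow M.carrier
  modelCategory := PathModel.modelCategory M.carrier

/-- The cylinder model `Cyl(M) = Ch(Mᵒᵖ)ᵒᵖ` of a model category `M`. -/
def cyl (M : ModQ.{v, u}) : ModQ.{v, max u v} :=
  M.op.path.op

/-- The full sub-2-category of `ModQ` on the model categories that satisfy `P`. -/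
abbrev FullSub (P : ModQ.{v, u} → Prop) :=
  Bicategory.InducedBicategory ModQ.{v, u} (fun M : {M : ModQ.{v, u} // P M} => M.1)

end ModQ

/-- A 1-morphism of a bicategory is an equivalence if it underlies an (adjoint) equivalence. -/
def IsEquivalenceOneCell {B : Type*} [Bicategory B] {a b : B} (f : a ⟶ b) : Prop :=
  ∃ e : Bicategory.Equivalence a b, e.hom = f

/-! A Quillen homotopy `τ : F ⟶ G` is the same as the functor `X ↦ (τ_X : F X ⟶ G X)` to the arrow
category, and this functor is left Quillen for the path model `Ch(N)` (`toPath`). Composing it with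
the two projections `Ch(N) ⟶ N` gives back `F` and `G`, and whiskering it with the tautological
2-morphism `δ` between the projections gives back `τ`. The constant path `s : N ⟶ Ch(N)` is a
Quillen equivalence, and `δ` restricted along `s` is invertible. Since `Φ` sends `s` to an
equivalence, and whiskering with an equivalence reflects invertibility, `Φ(δ)` is invertible, hence
so is `Φ(τ)`.

The work lies in `toPath`. If `i : X ⟶ Y` is a cofibration between cofibrant objects, the pushout
condition in `Ch(N)` follows from Reedy's lemma (`weakEquivalence_of_isPushout`), applied to the
weak equivalence `τ_X` between cofibrant objects. Nothing is known about `τ` at other objects. This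
is repaired by `cofibration_map_of_isCofibrant`, which rests on the fact that a fibration is trivial
as soon as it lifts against cofibrations between cofibrant objects.

For the cylinder the argument is applied to the opposite of `τ`, the conjugate transformation of
right adjoints. That this is again a Quillen homotopy (`weakEquivalence_conjugateEquiv_app`) also
follows from `toPath`, by K. Brown's lemma. Conjugation then turns the factorization through
`Ch(Mᵒᵖ)` into one of `τ` through `Cyl(M)`. -/

namespace HomotopicalAlgebra

/-! ### Reedy's lemma, and trivial fibrations detected by cofibrant objects -/

section Reedy

attribute [local simp] pullback.lift_fst pullback.lift_snd pushout.inl_desc pushout.inr_desc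
  pullback.lift_fst_assoc pullback.lift_snd_assoc pushout.inl_desc_assoc pushout.inr_desc_assoc
  coprod.inl_desc coprod.inr_desc coprod.inl_desc_assoc coprod.inr_desc_assoc

variable {C : Type u} [Category.{v} C] [ModelCategory C]

/-- Cobase change of a trivial cofibration `Z' ⨿_Z K ⟶ K'` along a map out of `K`. -/
lemma trivialCofibrations_of_isPushout_of_fac {Z Z' K K' Y P D : C} {j : Z ⟶ Z'} {c : Z ⟶ K}
    {k : K ⟶ K'} {m : Z' ⟶ K'} (w : j ≫ m = c ≫ k) {H : K ⟶ Y} {f : Z ⟶ Y} (hf : c ≫ H = f)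
    {a : Z' ⟶ P} {b : Y ⟶ P} (hP : IsPushout j f a b)
    {a' : K' ⟶ D} {b' : Y ⟶ D} (hD : IsPushout k H a' b')
    {d : P ⟶ D} (had : a ≫ d = m ≫ a') (hbd : b ≫ d = b')
    (h : trivialCofibrations C (pushout.desc m k w)) : trivialCofibrations C d := by
  subst hf
  -- `e` is the cobase change of `H`, so by pasting `d` is the cobase change of `Z' ⨿_Z K ⟶ K'`
  -- along `e`.
  let e : pushout j c ⟶ P := pushout.desc a (H ≫ b) (by simpa using hP.w)
  have he : IsPushout (pushout.inr j c) H e b := by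
    refine IsPushout.of_top (h₁₁ := j) (v₁₁ := c) (v₁₂ := pushout.inl j c) ?_ (by simp [e])
      (IsPushout.of_hasPushout j c)
    simpa [e] using hP
  have hd : IsPushout (pushout.desc m k w) e a' d := by
    refine IsPushout.of_left (h₁₁ := pushout.inr j c) (h₂₁ := b) (v₁₁ := H) ?_ ?_ he
    · simpa [hbd] using hD
    · apply pushout.hom_ext
      · simp [e, had]
      · simp [e, hbd, hD.w]
  exact MorphismProperty.of_isPushout hd.flip h

/-- A trivial fibration with a section that is a trivial cofibration stays a weak equivalence
after cobase change along a cofibration. -/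
lemma weakEquivalence_of_isPushout_of_section {Z Z' B B' : C} [IsCofibrant Z] {p : Z ⟶ B}
    {s : B ⟶ Z} (hs : s ≫ p = 𝟙 B) [Fibration p] [WeakEquivalence p] [Cofibration s]
    {j : Z ⟶ Z'} [Cofibration j] {a : Z' ⟶ B'} {b : B ⟶ B'} (h : IsPushout j p a b) :
    WeakEquivalence a := by
  -- The maps `p ≫ s` and `𝟙 Z` are homotopic over `B`. Extended over `Z'`, the homotopy links the
  -- cobase change of `j` along `𝟙 Z`, which is `Z'`, to the one along `p ≫ s`, which is equivalent
  -- to `B'` because `s` is a trivial cofibration.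
  have : WeakEquivalence s := weakEquivalence_of_postcomp_of_fac hs
  -- a cylinder of `Z`, and a homotopy from `p ≫ s` to the identity over `B`
  let hC := MorphismProperty.factorizationData (cofibrations C) (trivialFibrations C)
    (coprod.desc (𝟙 Z) (𝟙 Z))
  let c₀ : Z ⟶ hC.Z := coprod.inl ≫ hC.i
  let c₁ : Z ⟶ hC.Z := coprod.inr ≫ hC.i
  have hc₀ : c₀ ≫ hC.p = 𝟙 _ := by simp [c₀]
  have hc₁ : c₁ ≫ hC.p = 𝟙 _ := by simp [c₁]
  have : Cofibration c₀ := by dsimp [c₀]; infer_instance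
  have : Cofibration c₁ := by dsimp [c₁]; infer_instance
  have : WeakEquivalence c₀ := weakEquivalence_of_postcomp_of_fac hc₀
  have : WeakEquivalence c₁ := weakEquivalence_of_postcomp_of_fac hc₁
  have sqH : CommSq (coprod.desc (p ≫ s) (𝟙 Z)) hC.i p (hC.p ≫ p) := ⟨by
    apply coprod.hom_ext <;> simp [hs]⟩
  obtain ⟨H, hH, hH'⟩ : ∃ H : hC.Z ⟶ Z, hC.i ≫ H = coprod.desc (p ≫ s) (𝟙 Z) ∧
      H ≫ p = hC.p ≫ p := ⟨sqH.lift, by simp, by simp⟩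
  have hH₀ : c₀ ≫ H = p ≫ s := by simp [c₀, hH]
  have hH₁ : c₁ ≫ H = 𝟙 _ := by simp [c₁, hH]
  -- a cylinder of `Z'` relative to the cylinder of `Z`
  let U := pushout (c₁ ≫ pushout.inr j c₀) j
  have wU : c₁ ≫ pushout.inr j c₀ ≫ pushout.inl (c₁ ≫ pushout.inr j c₀) j =
      j ≫ pushout.inr _ _ := by rw [← Category.assoc, pushout.condition]
  let t : pushout j c₁ ⟶ U := pushout.desc (pushout.inr _ _) (pushout.inr j c₀ ≫ pushout.inl _ _)
    wU.symm
  have ht : IsPushout (pushout.inr j c₁) (pushout.inr j c₀) t (pushout.inl _ _) := by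
    refine IsPushout.of_top (h₁₁ := j) (v₁₁ := c₁) (v₁₂ := pushout.inl j c₁) ?_ (by simp [t])
      (IsPushout.of_hasPushout j c₁)
    simpa [t] using (IsPushout.of_hasPushout (c₁ ≫ pushout.inr j c₀) j).flip
  have : Cofibration t := by
    rw [cofibration_iff]
    exact MorphismProperty.of_isPushout ht (mem_cofibrations (pushout.inr j c₀))
  let r₀ : pushout j c₀ ⟶ Z' := pushout.desc (𝟙 _) (hC.p ≫ j) (by simp [reassoc_of% hc₀])
  let r : U ⟶ Z' := pushout.desc r₀ (𝟙 _) (by simp [r₀, reassoc_of% hc₁])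
  let hK := MorphismProperty.factorizationData (cofibrations C) (trivialFibrations C) r
  let k : hC.Z ⟶ hK.Z := pushout.inr j c₀ ≫ pushout.inl _ _ ≫ hK.i
  let m₀ : Z' ⟶ hK.Z := pushout.inl j c₀ ≫ pushout.inl _ _ ≫ hK.i
  let m₁ : Z' ⟶ hK.Z := pushout.inr _ _ ≫ hK.i
  have hk : k ≫ hK.p = hC.p ≫ j := by simp [k, r, r₀]
  have hm₀ : m₀ ≫ hK.p = 𝟙 _ := by simp [m₀, r, r₀]
  have hm₁ : m₁ ≫ hK.p = 𝟙 _ := by simp [m₁, r]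
  have : WeakEquivalence m₀ := weakEquivalence_of_postcomp_of_fac hm₀
  have : WeakEquivalence m₁ := weakEquivalence_of_postcomp_of_fac hm₁
  have w₀ : j ≫ m₀ = c₀ ≫ k := by simp [m₀, k, pushout.condition_assoc]
  have w₁ : j ≫ m₁ = c₁ ≫ k := by simp [m₁, k, ← reassoc_of% wU]
  -- Two out of three: both `m₀` and the cobase change of the trivial cofibration `c₀` are weak
  -- equivalences.
  have h₀ : trivialCofibrations C (pushout.desc m₀ k w₀) := by
    have e : pushout.desc m₀ k w₀ = pushout.inl _ _ ≫ hK.i := by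
      apply pushout.hom_ext <;> simp [m₀, k]
    have : WeakEquivalence (pushout.desc m₀ k w₀) :=
      weakEquivalence_of_precomp_of_fac (f := pushout.inl j c₀) (fg := m₀) (by simp)
    have : Cofibration (pushout.desc m₀ k w₀) := by rw [e]; infer_instance
    exact mem_trivialCofibrations _
  have h₁ : trivialCofibrations C (pushout.desc m₁ k w₁) := by
    have e : pushout.desc m₁ k w₁ = t ≫ hK.i := by
      apply pushout.hom_ext <;> simp [m₁, k, t]
    have : WeakEquivalence (pushout.desc m₁ k w₁) :=
      weakEquivalence_of_precomp_of_fac (f := pushout.inl j c₁) (fg := m₁) (by simp)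
    have : Cofibration (pushout.desc m₁ k w₁) := by rw [e]; infer_instance
    exact mem_trivialCofibrations _
  -- push the relative cylinder forward along the homotopy
  let d₀ : pushout j (p ≫ s) ⟶ pushout k H :=
    pushout.desc (m₀ ≫ pushout.inl _ _) (pushout.inr _ _) (by
      rw [reassoc_of% w₀, pushout.condition, reassoc_of% hH₀]
      exact (Category.assoc _ _ _).symm)
  let d₁ : Z' ⟶ pushout k H := m₁ ≫ pushout.inl _ _
  have hd₀ : WeakEquivalence d₀ := by
    rw [weakEquivalence_iff]
    exact (trivialCofibrations_of_isPushout_of_fac w₀ hH₀ (IsPushout.of_hasPushout _ _)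
      (IsPushout.of_hasPushout _ _) (by simp [d₀]) (by simp [d₀]) h₀).2
  have hd₁ : WeakEquivalence d₁ := by
    rw [weakEquivalence_iff]
    -- At this end the homotopy is the identity, so the cobase change of `j` is `Z'` itself.
    refine (trivialCofibrations_of_isPushout_of_fac w₁ hH₁ (a := 𝟙 _) (b := j)
      (IsPushout.of_vert_isIso ⟨by simp⟩)
      (IsPushout.of_hasPushout _ _) (by simp [d₁]) ?_ h₁).2
    simp only [d₁, reassoc_of% w₁, pushout.condition, reassoc_of% hH₁]
  -- `φ` exists because the homotopy lies over `B`. It is a weak equivalence by comparison with the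
  -- first end, and restricts to `a` at the second.
  let φ : pushout k H ⟶ B' := pushout.desc (hK.p ≫ a) (p ≫ b) (by
    rw [reassoc_of% hk, reassoc_of% hH', h.w])
  let σ : B' ⟶ pushout j (p ≫ s) := h.desc (pushout.inl _ _) (s ≫ pushout.inr _ _) (by
    simpa using pushout.condition (f := j) (g := p ≫ s))
  have hσ : IsPushout b s σ (pushout.inr _ _) := by
    refine IsPushout.of_top (h₁₁ := j) (v₁₁ := p) (v₁₂ := a) ?_ (by simp [σ]) h
    simpa [σ] using IsPushout.of_hasPushout j (p ≫ s)
  have : WeakEquivalence σ := by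
    rw [weakEquivalence_iff]
    exact (MorphismProperty.of_isPushout hσ (mem_trivialCofibrations s)).2
  have hσφ : σ ≫ d₀ ≫ φ = 𝟙 _ := by
    apply h.hom_ext
    · simp [σ, d₀, φ, reassoc_of% hm₀]
    · simp [σ, d₀, φ, reassoc_of% hs]
  have : WeakEquivalence (d₀ ≫ φ) := weakEquivalence_of_precomp_of_fac hσφ
  have : WeakEquivalence φ := weakEquivalence_of_precomp d₀ φ
  have hφ : d₁ ≫ φ = a := by simp [d₁, φ, reassoc_of% hm₁]
  rw [← hφ]
  infer_instance

/-- Reedy's lemma: a cobase change along a cofibration of a weak equivalence between cofibrant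
objects is a weak equivalence. -/
lemma weakEquivalence_of_isPushout {A A' B B' : C} [IsCofibrant A] [IsCofibrant B]
    {f : A ⟶ B} [WeakEquivalence f] {j : A ⟶ A'} [Cofibration j] {a : A' ⟶ B'} {b : B ⟶ B'}
    (h : IsPushout j f a b) : WeakEquivalence a := by
  -- The factor `hf.i` is a trivial cofibration, stable under cobase change. The factor `hf.p` has a
  -- cofibration as a section, so the previous lemma applies to it.
  let hf : CofibrantBrownFactorization f := Classical.arbitrary _
  have : IsCofibrant hf.Z := isCofibrant_of_cofibration hf.i
  let φ : pushout j hf.i ⟶ B' := pushout.desc a (hf.p ≫ b) (by simp [h.w])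
  have hφ : IsPushout (pushout.inr j hf.i) hf.p φ b := by
    refine IsPushout.of_top (h₁₁ := j) (v₁₁ := hf.i) (v₁₂ := pushout.inl _ _) ?_ (by simp [φ])
      (IsPushout.of_hasPushout _ _)
    simpa [φ] using h
  have : WeakEquivalence φ := weakEquivalence_of_isPushout_of_section hf.s_p hφ
  have e : pushout.inl j hf.i ≫ φ = a := by simp [φ]
  rw [← e]
  infer_instance

/-- A morphism between cofibrant objects with a cofibration as a section is a weak equivalence
if it has the right lifting property with respect to cofibrations between cofibrant objects. -/
lemma weakEquivalence_of_rlp_of_section {E B : C} [IsCofibrant B] {p : E ⟶ B} {j : B ⟶ E}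
    [Cofibration j] (hj : j ≫ p = 𝟙 B)
    (hp : ∀ {X Y : C} (i : X ⟶ Y) [IsCofibrant X] [Cofibration i], HasLiftingProperty i p) :
    WeakEquivalence p := by
  have : IsCofibrant E := isCofibrant_of_cofibration j
  have : IsCofibrant (pushout j j) := isCofibrant_of_cofibration (pushout.inl j j)
  -- A cylinder of `E` relative to `B`. Its ends form the cofibrant object `pushout j j`, so `p`
  -- lifts against `hC.i`; the lift is a homotopy from `𝟙 E` to `p ≫ j`.
  let hC := MorphismProperty.factorizationData (cofibrations C) (trivialFibrations C)
    (pushout.desc (𝟙 E) (𝟙 E) rfl : pushout j j ⟶ E)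
  let c₀ : E ⟶ hC.Z := pushout.inl _ _ ≫ hC.i
  let c₁ : E ⟶ hC.Z := pushout.inr _ _ ≫ hC.i
  have hc₀ : c₀ ≫ hC.p = 𝟙 _ := by simp [c₀]
  have hc₁ : c₁ ≫ hC.p = 𝟙 _ := by simp [c₁]
  have : WeakEquivalence c₀ := weakEquivalence_of_postcomp_of_fac hc₀
  have : WeakEquivalence c₁ := weakEquivalence_of_postcomp_of_fac hc₁
  have sq : CommSq (pushout.desc (𝟙 E) (p ≫ j) (by simp [reassoc_of% hj])) hC.i p (hC.p ≫ p) :=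
    ⟨by apply pushout.hom_ext <;> simp [hj]⟩
  have := hp hC.i
  have h₀ : c₀ ≫ sq.lift = 𝟙 _ := by simp [c₀]
  have h₁ : c₁ ≫ sq.lift = p ≫ j := by simp [c₁]
  have : WeakEquivalence sq.lift := weakEquivalence_of_precomp_of_fac h₀
  have hpj : WeakEquivalence (p ≫ j) := by rw [← h₁]; infer_instance
  rw [weakEquivalence_iff] at hpj ⊢
  -- `p` is a retract of `p ≫ j`, by `j` and `p` on the targets.
  refine MorphismProperty.of_retract (f := p) (g := p ≫ j)
    { i := Arrow.homMk (𝟙 E) j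
      r := Arrow.homMk (𝟙 E) p (by simp [hj])
      retract := Arrow.hom_ext _ _ (by simp) (by simpa using hj) } hpj

/-- A fibration is trivial if it has the right lifting property with respect to cofibrations
between cofibrant objects. -/
lemma weakEquivalence_of_rlp_of_isCofibrant {E B : C} {p : E ⟶ B} [Fibration p]
    (hp : ∀ {X Y : C} (i : X ⟶ Y) [IsCofibrant X] [Cofibration i], HasLiftingProperty i p) :
    WeakEquivalence p := by
  -- Base change to a cofibrant replacement of `B`, where `p` acquires a section.
  let hQ := MorphismProperty.factorizationData (cofibrations C) (trivialFibrations C)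
    (initial.to B)
  have : IsCofibrant hQ.Z := by
    rw [isCofibrant_iff, Subsingleton.elim (initial.to hQ.Z) hQ.i]; infer_instance
  have hp' : ∀ {X Y : C} (i : X ⟶ Y) [IsCofibrant X] [Cofibration i],
      HasLiftingProperty i (pullback.snd p hQ.p) := fun i _ _ => by
    have := hp i
    exact (IsPullback.of_hasPullback p hQ.p).hasLiftingProperty i
  have : IsCofibrant (⊥_ C) := by
    rw [isCofibrant_iff, Subsingleton.elim (initial.to (⊥_ C)) (𝟙 _)]; infer_instance
  have := hp' (initial.to hQ.Z)
  have sq : CommSq (initial.to (pullback p hQ.p)) (initial.to hQ.Z) (pullback.snd p hQ.p) (𝟙 _) :=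
    ⟨Subsingleton.elim _ _⟩
  -- The section need not be a cofibration; its factorization replaces the total space by one where
  -- it is.
  let hσ := MorphismProperty.factorizationData (cofibrations C) (trivialFibrations C) sq.lift
  have h₁ : WeakEquivalence (hσ.p ≫ pullback.snd p hQ.p) := by
    refine weakEquivalence_of_rlp_of_section (j := hσ.i) (by simp) (fun i _ _ => ?_)
    have := hp' i
    infer_instance
  have h₂ : WeakEquivalence (pullback.snd p hQ.p) := weakEquivalence_of_precomp hσ.p _
  have h₃ : WeakEquivalence (pullback.fst p hQ.p ≫ p) := by
    rw [pullback.condition]; infer_instance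
  exact weakEquivalence_of_precomp (pullback.fst p hQ.p) p

end Reedy

end HomotopicalAlgebra

/-! ### The right adjoint of the functor to the arrow category -/

section ArrowLift

variable {C D : Type*} [Category* C] [Category* D] {F G : C ⥤ D} {F' G' : D ⥤ C}

namespace CategoryTheory

/-- Precomposition with `τ` transposes to postcomposition with its conjugate. Hence a square under
`τ_X` transposes to a map into a pullback of right adjoints. -/
lemma Adjunction.homEquiv_comp_conjugateEquiv_app (adjF : F ⊣ F') (adjG : G ⊣ G') (τ : F ⟶ G)
    {X : C} {Y : D} (g : G.obj X ⟶ Y) :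
    adjG.homEquiv X Y g ≫ (conjugateEquiv adjG adjF τ).app Y =
      adjF.homEquiv X Y (τ.app X ≫ g) := by
  rw [Adjunction.homEquiv_unit, Adjunction.homEquiv_unit, Category.assoc, NatTrans.naturality,
    ← Category.assoc, unit_conjugateEquiv, Category.assoc, Functor.map_comp]

/-- The functor to the arrow category given by a natural transformation. -/
@[simps]
def NatTrans.toArrow (τ : F ⟶ G) : C ⥤ Arrow D where
  obj X := Arrow.mk (τ.app X)
  map f := Arrow.homMk (F.map f) (G.map f)

variable [HasPullbacks C] (adjF : F ⊣ F') (adjG : G ⊣ G') (τ : F ⟶ G)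

attribute [local simp] pullback.lift_fst pullback.lift_snd pullback.lift_fst_assoc
  pullback.lift_snd_assoc

/-- The right adjoint of `NatTrans.toArrow τ`. -/
@[simps]
noncomputable def Adjunction.fromArrow : Arrow D ⥤ C where
  obj y := pullback (F'.map y.hom) ((conjugateEquiv adjG adjF τ).app y.right)
  map {x y} f := pullback.map _ _ _ _ (F'.map f.left) (G'.map f.right) (F'.map f.right)
    (by simp only [← Functor.map_comp, Arrow.w]) (NatTrans.naturality _ _).symm
  map_id x := by apply pullback.hom_ext <;> simp
  map_comp f g := by apply pullback.hom_ext <;> simp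

/-- The bijection between commutative squares with top `τ.app X` and morphisms to a pullback. -/
@[simps apply symm_apply]
noncomputable def Adjunction.arrowHomEquiv (X : C) (y : Arrow D) :
    (Arrow.mk (τ.app X) ⟶ y) ≃
      (X ⟶ pullback (F'.map y.hom) ((conjugateEquiv adjG adjF τ).app y.right)) where
  toFun f := pullback.lift (adjF.homEquiv X y.left f.left) (adjG.homEquiv X y.right f.right) (by
    have : f.left ≫ y.hom = τ.app X ≫ f.right := f.w
    rw [homEquiv_comp_conjugateEquiv_app, ← this]
    exact (adjF.homEquiv_naturality_right _ _).symm)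
  invFun g := Arrow.homMk ((adjF.homEquiv X y.left).symm (g ≫ pullback.fst _ _))
    ((adjG.homEquiv X y.right).symm (g ≫ pullback.snd _ _)) (by
      apply (adjF.homEquiv _ _).injective
      refine (adjF.homEquiv_naturality_right _ _).trans
        (Eq.trans ?_ (adjF.homEquiv_comp_conjugateEquiv_app adjG τ _))
      simp [pullback.condition, -conjugateEquiv_apply_app])
  left_inv f := Arrow.hom_ext _ _
    ((congrArg _ (pullback.lift_fst _ _ _)).trans ((adjF.homEquiv _ _).symm_apply_apply _))
    ((congrArg _ (pullback.lift_snd _ _ _)).trans ((adjG.homEquiv _ _).symm_apply_apply _))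
  right_inv g := pullback.hom_ext
    ((pullback.lift_fst _ _ _).trans ((adjF.homEquiv _ _).apply_symm_apply _))
    ((pullback.lift_snd _ _ _).trans ((adjG.homEquiv _ _).apply_symm_apply _))

/-- The adjunction between `NatTrans.toArrow τ` and `Adjunction.fromArrow`. -/
noncomputable def Adjunction.arrowAdjunction : τ.toArrow ⊣ adjF.fromArrow adjG τ :=
  Adjunction.mkOfHomEquiv
    { homEquiv X y := adjF.arrowHomEquiv adjG τ X y
      homEquiv_naturality_left_symm _ _ := Arrow.hom_ext _ _
        ((congrArg _ (Category.assoc _ _ _)).trans (adjF.homEquiv_naturality_left_symm _ _))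
        ((congrArg _ (Category.assoc _ _ _)).trans (adjG.homEquiv_naturality_left_symm _ _))
      homEquiv_naturality_right _ _ := pullback.hom_ext
        (((pullback.lift_fst _ _ _).trans (adjF.homEquiv_naturality_right _ _)).trans
          ((Category.assoc _ _ _).trans ((congrArg _ (pullback.lift_fst _ _ _)).trans
            (pullback.lift_fst_assoc _ _ _ _))).symm)
        (((pullback.lift_snd _ _ _).trans (adjG.homEquiv_naturality_right _ _)).trans
          ((Category.assoc _ _ _).trans ((congrArg _ (pullback.lift_snd _ _ _)).trans
            (pullback.lift_snd_assoc _ _ _ _))).symm) }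

end CategoryTheory

end ArrowLift

/-! ### Left Quillen functors tested on cofibrant objects -/

namespace HomotopicalAlgebra

variable {C D : Type*} [Category* C] [Category* D] [ModelCategory C] [ModelCategory D]
  {L : C ⥤ D} {R : D ⥤ C}

section

variable (adj : L ⊣ R)
  (h₁ : ∀ {X Y : C} (i : X ⟶ Y) [Cofibration i] [WeakEquivalence i],
    Cofibration (L.map i) ∧ WeakEquivalence (L.map i))

include adj h₁ in
lemma fibration_map_of_adjunction {X Y : D} (p : X ⟶ Y) [Fibration p] : Fibration (R.map p) := by
  rw [fibration_iff, ← trivialCofibrations_rlp]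
  intro A B i hi
  rw [mem_trivialCofibrations_iff] at hi
  obtain ⟨_, _⟩ := hi
  obtain ⟨_, _⟩ := h₁ i
  rw [← adj.hasLiftingProperty_iff]
  infer_instance

include adj h₁ in
/-- A left adjoint that preserves trivial cofibrations and cofibrations between cofibrant objects
preserves all cofibrations. -/
lemma cofibration_map_of_isCofibrant
    (h₂ : ∀ {X Y : C} (i : X ⟶ Y) [IsCofibrant X] [IsCofibrant Y] [Cofibration i],
      Cofibration (L.map i))
    {X Y : C} (i : X ⟶ Y) [Cofibration i] : Cofibration (L.map i) := by
  rw [cofibration_iff, ← trivialFibrations_llp]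
  intro A B p hp
  rw [mem_trivialFibrations_iff] at hp
  obtain ⟨_, _⟩ := hp
  have := fibration_map_of_adjunction adj h₁ p
  -- Lifting `R.map p` against a cofibration between cofibrant objects transposes to a case covered
  -- by `h₂`.
  have : WeakEquivalence (R.map p) := weakEquivalence_of_rlp_of_isCofibrant fun j _ _ => by
    have := isCofibrant_of_cofibration j
    have := h₂ j
    rw [← adj.hasLiftingProperty_iff]
    infer_instance
  rw [adj.hasLiftingProperty_iff]
  infer_instance

end

end HomotopicalAlgebra

/-! ### Quillen homotopies as Quillen adjunctions to the path model -/

namespace QuillenAdjunction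

variable {C : Type u} [Category.{v} C] [ModelCategory C]
  {D : Type u} [Category.{v} D] [ModelCategory D]

section

variable (F : QuillenAdjunction C D)

lemma fibration_map {X Y : D} (p : X ⟶ Y) [Fibration p] : Fibration (F.right.map p) :=
  fibration_map_of_adjunction F.adj
    (fun _ h h' => ⟨F.map_cofibration _ h, F.map_weakEquivalence _ h h'⟩) p

lemma trivialFibrations_map {X Y : D} (p : X ⟶ Y) [Fibration p] [WeakEquivalence p] :
    trivialFibrations C (F.right.map p) := by
  rw [← cofibrations_rlp]
  intro A B i hi
  rw [← cofibration_iff] at hi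
  have := F.map_cofibration i hi
  rw [← F.adj.hasLiftingProperty_iff]
  infer_instance

lemma isCofibrant_obj (X : C) [IsCofibrant X] : IsCofibrant (F.left.obj X) := by
  have : PreservesColimitsOfSize.{0, 0} F.left := F.adj.leftAdjoint_preservesColimits
  rw [isCofibrant_iff_of_isInitial (F.left.map (initial.to X))
    (IsInitial.isInitialObj F.left _ initialIsInitial)]
  exact F.map_cofibration _ ‹_›

/-- K. Brown's lemma for right Quillen functors. -/
lemma weakEquivalence_right_map {X Y : D} [IsFibrant X] [IsFibrant Y] (f : X ⟶ Y)
    [WeakEquivalence f] : WeakEquivalence (F.right.map f) := by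
  let h : FibrantBrownFactorization f := Classical.arbitrary _
  have := h.fibration_r
  obtain ⟨_, _⟩ := (mem_trivialFibrations_iff _).1 (F.trivialFibrations_map h.p)
  obtain ⟨_, _⟩ := (mem_trivialFibrations_iff _).1 (F.trivialFibrations_map h.r)
  have : WeakEquivalence (F.right.map h.i) :=
    weakEquivalence_of_postcomp_of_fac (g := F.right.map h.r) (fg := 𝟙 _)
      (by rw [← F.right.map_comp, h.i_r, F.right.map_id])
  rw [← h.fac, F.right.map_comp]
  infer_instance

end

section

attribute [local instance] PathModel.modelCategory

variable {C : Type (max u v)} [Category.{v} C] [ModelCategory C]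
  {D : Type (max u v)} [Category.{v} D] [ModelCategory D]
  {F G : QuillenAdjunction C D} {τ : F ⟶ G}

/-- Two out of three: the map from `G X` to the pushout is a cobase change of the trivial
cofibration `F i`, and composed with the comparison map it is the weak equivalence `G i`. The
2-morphism `τ` is arbitrary here. -/
lemma map_toArrow_of_weakEquivalence (τ : F ⟶ G) {X Y : C} (i : X ⟶ Y) [hi : Cofibration i]
    [hi' : WeakEquivalence i] :
    Cofibration (τ.natTrans.toArrow.map i) ∧ WeakEquivalence (τ.natTrans.toArrow.map i) := by
  rw [PathModel.cofibration_iff', PathModel.weakEquivalence_iff']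
  have h₁ : Cofibration (F.left.map i) := F.map_cofibration i hi
  have h₂ : Cofibration (G.left.map i) := G.map_cofibration i hi
  have h₃ : WeakEquivalence (F.left.map i) := F.map_weakEquivalence i hi hi'
  have h₄ : WeakEquivalence (G.left.map i) := G.map_weakEquivalence i hi hi'
  refine ⟨⟨h₁, h₂, ?_⟩, h₃⟩
  have : Cofibration (τ.natTrans.toArrow.map i).left := h₁
  have : WeakEquivalence (τ.natTrans.toArrow.map i).left := h₃
  have : WeakEquivalence (τ.natTrans.toArrow.map i).right := h₄
  exact weakEquivalence_of_precomp_of_fac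
    (PathModel.inl_fromPushout (Arrow.w (τ.natTrans.toArrow.map i)))

/-- A Quillen homotopy, regarded as a Quillen adjunction to the path model. -/
@[simps left right adj]
noncomputable def toPath (hτ : IsQuillenHomotopy τ) : QuillenAdjunction C (Arrow D) where
  left := τ.natTrans.toArrow
  right := F.adj.fromArrow G.adj τ.natTrans
  adj := F.adj.arrowAdjunction G.adj τ.natTrans
  map_cofibration i _ := by
    refine cofibration_map_of_isCofibrant (F.adj.arrowAdjunction G.adj τ.natTrans)
      (map_toArrow_of_weakEquivalence τ) (fun {X Y} i _ _ _ => ?_) i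
    rw [PathModel.cofibration_iff']
    have h₁ : Cofibration (F.left.map i) := F.map_cofibration i ‹_›
    refine ⟨h₁, G.map_cofibration i ‹_›, ?_⟩
    have := hτ X ‹_›
    have := F.isCofibrant_obj X
    have := G.isCofibrant_obj X
    have : WeakEquivalence (τ.natTrans.toArrow.obj Y).hom := hτ Y ‹_›
    -- Reedy's lemma for `τ_X` and the cofibration `F i`. Composed with the comparison map, this
    -- gives `τ_Y`.
    have h₂ : WeakEquivalence (pushout.inr (τ.natTrans.app X) (F.left.map i)) :=
      weakEquivalence_of_isPushout
        (IsPushout.of_hasPushout (τ.natTrans.app X) (F.left.map i)).flip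
    have : WeakEquivalence (pushout.inr (τ.natTrans.toArrow.obj X).hom
        (τ.natTrans.toArrow.map i).left) := h₂
    exact weakEquivalence_of_precomp_of_fac
      (PathModel.inr_fromPushout (Arrow.w (τ.natTrans.toArrow.map i)))
  map_weakEquivalence i _ _ := (map_toArrow_of_weakEquivalence τ i).2

/-- The terminal arrow is `𝟙 (⊤_ D)`, so the comparison map to the pullback is `x` up to
isomorphism. -/
lemma isFibrant_arrow {X Y : D} (x : X ⟶ Y) [IsFibrant Y] [hx : Fibration x] :
    IsFibrant (Arrow.mk x) := by
  have hT : IsTerminal (Arrow.mk (𝟙 (⊤_ D))) :=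
    IsTerminal.ofUniqueHom (fun Z => Arrow.homMk (terminal.from _) (terminal.from _))
      (fun Z m => Arrow.hom_ext _ _ (terminalIsTerminal.hom_ext _ _) (terminalIsTerminal.hom_ext _ _))
  rw [isFibrant_iff_of_isTerminal (hT.from _) hT, PathModel.fibration_iff']
  constructor
  · have e : (hT.from (Arrow.mk x)).right = terminal.from Y :=
      terminalIsTerminal.hom_ext _ _
    rw [e]
    infer_instance
  · have : IsIso (pullback.snd (𝟙 (⊤_ D)) ((hT.from (Arrow.mk x)).right)) := inferInstance
    have e : PathModel.toPullback (Arrow.w (hT.from (Arrow.mk x))) =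
      x ≫ inv (pullback.snd (𝟙 (⊤_ D)) ((hT.from (Arrow.mk x)).right)) := by
      rw [IsIso.eq_comp_inv]
      exact PathModel.toPullback_snd _
    rw [e]
    infer_instance

/-- The transformation of right adjoints conjugate to a Quillen homotopy is a weak equivalence
on fibrant objects. -/
lemma weakEquivalence_conjugateEquiv_app (hτ : IsQuillenHomotopy τ) (Y : D) [IsFibrant Y] :
    WeakEquivalence ((conjugateEquiv G.adj F.adj τ.natTrans).app Y) := by
  -- The right adjoint of `toPath` sends `x` to `F♭ Y ×_{F♭ Y} G♭ Y ≅ G♭ Y` and `y` to `F♭ Y ×_{F♭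
  -- ⊤} G♭ ⊤ ≅ F♭ Y`. It sends the weak equivalence `x ⟶ y` of fibrant objects to the conjugate of
  -- `τ`, up to these isomorphisms.
  let x : Arrow D := Arrow.mk (𝟙 Y)
  let y : Arrow D := Arrow.mk (terminal.from Y)
  have : IsFibrant (⊤_ D) := by
    rw [isFibrant_iff, Subsingleton.elim (terminal.from (⊤_ D)) (𝟙 _)]; infer_instance
  have : IsFibrant x := isFibrant_arrow (𝟙 Y)
  have : IsFibrant y := isFibrant_arrow (terminal.from Y)
  let f : x ⟶ y := Arrow.homMk (𝟙 Y) (terminal.from Y)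
  have : WeakEquivalence f := by
    rw [PathModel.weakEquivalence_iff']
    exact inferInstanceAs (WeakEquivalence (𝟙 Y))
  have hR : WeakEquivalence ((F.adj.fromArrow G.adj τ.natTrans).map f) :=
    (toPath hτ).weakEquivalence_right_map f
  have : PreservesLimitsOfSize.{0, 0} F.right := F.adj.rightAdjoint_preservesLimits
  have : PreservesLimitsOfSize.{0, 0} G.right := G.adj.rightAdjoint_preservesLimits
  have : IsIso ((conjugateEquiv G.adj F.adj τ.natTrans).app (⊤_ D)) :=
    isIso_of_isTerminal (IsTerminal.isTerminalObj G.right _ terminalIsTerminal)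
      (IsTerminal.isTerminalObj F.right _ terminalIsTerminal) _
  have h₁ : WeakEquivalence (pullback.fst (F.right.map (terminal.from Y))
      ((conjugateEquiv G.adj F.adj τ.natTrans).app (⊤_ D))) := inferInstance
  have h₂ : WeakEquivalence (pullback.snd (F.right.map (𝟙 Y))
      ((conjugateEquiv G.adj F.adj τ.natTrans).app Y)) := inferInstance
  have e : pullback.snd (F.right.map (𝟙 Y)) ((conjugateEquiv G.adj F.adj τ.natTrans).app Y) ≫
      (conjugateEquiv G.adj F.adj τ.natTrans).app Y =
      (F.adj.fromArrow G.adj τ.natTrans).map f ≫ pullback.fst _ _ := by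
    rw [← pullback.condition]
    exact (pullback.lift_fst _ _ _).symm
  have h₃ : WeakEquivalence
      (pullback.snd (F.right.map (𝟙 Y)) ((conjugateEquiv G.adj F.adj τ.natTrans).app Y) ≫
        (conjugateEquiv G.adj F.adj τ.natTrans).app Y) := by
    rw [weakEquivalence_iff, e]
    exact (weakEquivalences C).comp_mem _ _ hR.mem h₁.mem
  exact weakEquivalence_of_precomp
    (pullback.snd (F.right.map (𝟙 Y)) ((conjugateEquiv G.adj F.adj τ.natTrans).app Y)) _

end

end QuillenAdjunction

/-! ### Projections of the path model, and the constant path -/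

namespace QuillenAdjunction

section Path

attribute [local instance] PathModel.modelCategory

variable (D : Type (max u v)) [Category.{v} D] [ModelCategory D]

/-- The projection `x ↦ X₀` of the path model. -/
@[simps left]
noncomputable def pathSource : QuillenAdjunction (Arrow D) D where
  left := Arrow.leftFunc
  right :=
    { obj Y := Arrow.mk (terminal.from Y)
      map f := Arrow.homMk f (𝟙 _) (terminalIsTerminal.hom_ext _ _)
      map_comp f g := Arrow.hom_ext _ _ rfl (terminalIsTerminal.hom_ext _ _) }
  adj := Adjunction.mkOfHomEquiv
    { homEquiv x Y :=
        { toFun f := Arrow.homMk f (terminal.from _) (terminalIsTerminal.hom_ext _ _)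
          invFun f := f.left
          left_inv _ := rfl
          right_inv _ := Arrow.hom_ext _ _ rfl (terminalIsTerminal.hom_ext _ _) }
      homEquiv_naturality_left_symm _ _ := rfl
      homEquiv_naturality_right _ _ :=
        Arrow.hom_ext _ _ rfl (terminalIsTerminal.hom_ext _ _) }
  map_cofibration f hf := ((PathModel.cofibration_iff' f).1 hf).1
  map_weakEquivalence f _ hf := (PathModel.weakEquivalence_iff' f).1 hf

/-- The projection `x ↦ X₁` of the path model. -/
@[simps left]
noncomputable def pathTarget : QuillenAdjunction (Arrow D) D where
  left := Arrow.rightFunc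
  right :=
    { obj Y := Arrow.mk (𝟙 Y)
      map f := Arrow.homMk f f ((Category.comp_id f).trans (Category.id_comp f).symm) }
  adj := Adjunction.mkOfHomEquiv
    { homEquiv x Y :=
        { toFun f := Arrow.homMk (x.hom ≫ f) f (Category.comp_id _)
          invFun f := f.right
          left_inv _ := rfl
          right_inv f := Arrow.hom_ext _ _ (f.w.symm.trans (Category.comp_id _)) rfl }
      homEquiv_naturality_left_symm _ _ := rfl
      homEquiv_naturality_right _ _ :=
        Arrow.hom_ext _ _ (Category.assoc _ _ _).symm rfl }
  map_cofibration f hf := ((PathModel.cofibration_iff' f).1 hf).2.1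
  map_weakEquivalence f hf hf' := by
    -- Weak equivalences only see level `0`; for a cofibration the pushout condition carries them to
    -- level `1`.
    obtain ⟨_, _, _⟩ := (PathModel.cofibration_iff' f).1 hf
    have := (PathModel.weakEquivalence_iff' f).1 hf'
    change WeakEquivalence f.right
    exact PathModel.weakEquivalence_of_fromPushout (Arrow.w f)

/-- The 2-morphism between the projections of the path model. -/
@[simps]
noncomputable def pathProj : pathSource D ⟶ pathTarget D where
  natTrans := Arrow.leftToRight

lemma isQuillenHomotopy_id (C : Type u) [Category.{v} C] [ModelCategory C] :
    IsQuillenHomotopy (𝟙 (QuillenAdjunction.id C)) :=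
  fun X _ => inferInstanceAs (WeakEquivalence (𝟙 X))

/-- The constant path `Y ↦ 𝟙 Y`. -/
@[simps left]
noncomputable def pathConst : QuillenAdjunction D (Arrow D) where
  left := NatTrans.toArrow (𝟙 (𝟭 D))
  right := Arrow.leftFunc
  adj := Adjunction.mkOfHomEquiv
    { homEquiv _ y :=
        { toFun f := f.left
          invFun f := Arrow.homMk f (f ≫ y.hom) (Category.id_comp _).symm
          left_inv f := Arrow.hom_ext _ _ rfl (f.w.trans (Category.id_comp _))
          right_inv _ := rfl }
      homEquiv_naturality_left_symm _ _ := Arrow.hom_ext _ _ rfl (Category.assoc _ _ _)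
      homEquiv_naturality_right _ _ := rfl }
  -- The constant path is the path of the identity homotopy.
  map_cofibration f hf := (toPath (isQuillenHomotopy_id D)).map_cofibration f hf
  map_weakEquivalence f hf hf' := (toPath (isQuillenHomotopy_id D)).map_weakEquivalence f hf hf'

lemma pathConst_homEquiv {X : D} {y : Arrow D} (f : (pathConst D).left.obj X ⟶ y) :
    (pathConst D).adj.homEquiv X y f = f.left := by
  simp only [pathConst, Adjunction.mkOfHomEquiv_homEquiv]
  rfl

/-- The adjunct of `f` is its level `0` component, and that is where weak equivalences of the path
model are defined. -/
lemma isQuillenEquivalence_pathConst : (pathConst D).IsQuillenEquivalence := by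
  intro X y _ _ f
  rw [pathConst_homEquiv]
  exact PathModel.weakEquivalence_iff' f

end Path

/-! ### Opposite Quillen adjunctions, without double opposites -/

section Opposite

open Opposite

variable {C : Type u} [Category.{v} C] [ModelCategory C]
  {D : Type u} [Category.{v} D] [ModelCategory D]

/-- The opposite of a Quillen adjunction. -/
@[simps left right]
def op (F : QuillenAdjunction C D) : QuillenAdjunction Dᵒᵖ Cᵒᵖ where
  left := F.right.op
  right := F.left.op
  adj := F.adj.op
  map_cofibration f hf := by
    have := F.fibration_map f.unop
    exact inferInstanceAs (Cofibration (F.right.map f.unop).op)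
  map_weakEquivalence f hf hf' := by
    obtain ⟨_, _⟩ := (mem_trivialFibrations_iff _).1 (F.trivialFibrations_map f.unop)
    exact inferInstanceAs (WeakEquivalence (F.right.map f.unop).op)

/-- The opposite of a Quillen adjunction whose source is an opposite category. -/
@[simps left right]
def leftOp (F : QuillenAdjunction Cᵒᵖ D) : QuillenAdjunction Dᵒᵖ C where
  left := F.right.leftOp
  right := F.left.rightOp
  adj :=
    { unit := { app X := (F.adj.counit.app X.unop).op
                naturality X Y f := Quiver.Hom.unop_inj (F.adj.counit.naturality f.unop).symm }
      counit := { app Y := (F.adj.unit.app (.op Y)).unop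
                  naturality X Y f := Quiver.Hom.op_inj (F.adj.unit.naturality f.op).symm }
      left_triangle_components X := Quiver.Hom.op_inj (F.adj.right_triangle_components X.unop)
      right_triangle_components Y :=
        Quiver.Hom.unop_inj (F.adj.left_triangle_components (.op Y)) }
  map_cofibration f hf := by
    have := F.fibration_map f.unop
    exact inferInstanceAs (Cofibration (F.right.map f.unop).unop)
  map_weakEquivalence f hf hf' := by
    obtain ⟨_, _⟩ := (mem_trivialFibrations_iff _).1 (F.trivialFibrations_map f.unop)
    exact inferInstanceAs (WeakEquivalence (F.right.map f.unop).unop)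

/-- The opposite of a Quillen adjunction whose target is an opposite category. -/
@[simps left right]
def rightOp (F : QuillenAdjunction C Dᵒᵖ) : QuillenAdjunction D Cᵒᵖ where
  left := F.right.rightOp
  right := F.left.leftOp
  adj :=
    { unit := { app X := (F.adj.counit.app (.op X)).unop
                naturality X Y f := Quiver.Hom.op_inj (F.adj.counit.naturality f.op).symm }
      counit := { app Y := (F.adj.unit.app Y.unop).op
                  naturality X Y f := Quiver.Hom.unop_inj (F.adj.unit.naturality f.unop).symm }
      left_triangle_components X := Quiver.Hom.unop_inj (F.adj.right_triangle_components (.op X))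
      right_triangle_components Y :=
        Quiver.Hom.op_inj (F.adj.left_triangle_components Y.unop) }
  map_cofibration f hf := by
    have := F.fibration_map f.op
    exact inferInstanceAs (Cofibration (F.right.map f.op).op)
  map_weakEquivalence f hf hf' := by
    obtain ⟨_, _⟩ := (mem_trivialFibrations_iff _).1 (F.trivialFibrations_map f.op)
    exact inferInstanceAs (WeakEquivalence (F.right.map f.op).op)

lemma isCofibrant_op (Y : D) [hY : IsFibrant Y] : IsCofibrant (Opposite.op Y) := by
  rw [isCofibrant_iff_of_isInitial (terminal.from Y).op
    (initialOpOfTerminal terminalIsTerminal)]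
  infer_instance

lemma isFibrant_unop (Y : Dᵒᵖ) [hY : IsCofibrant Y] : IsFibrant Y.unop := by
  rw [isFibrant_iff_of_isTerminal (initial.to Y).unop
    (terminalUnopOfInitial initialIsInitial)]
  infer_instance

lemma leftOp_homEquiv (F : QuillenAdjunction Cᵒᵖ D) {X : Dᵒᵖ} {Y : C}
    (f : (F.right.obj X.unop).unop ⟶ Y) :
    F.leftOp.adj.homEquiv X Y f = ((F.adj.homEquiv (.op Y) X.unop).symm f.op).op :=
  (F.leftOp.adj.homEquiv_unit _ _ _).trans
    (congrArg Quiver.Hom.op (F.adj.homEquiv_counit _ _ f.op).symm)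

/-- Passing to opposites exchanges cofibrant with fibrant objects and reverses transposition, so
this is the condition on `F` read backwards. -/
lemma IsQuillenEquivalence.leftOp {F : QuillenAdjunction Cᵒᵖ D} (hF : F.IsQuillenEquivalence) :
    F.leftOp.IsQuillenEquivalence := by
  intro X Y _ _ (f : (F.right.obj X.unop).unop ⟶ Y)
  have := isCofibrant_op Y
  have := isFibrant_unop X
  have h := hF (.op Y) X.unop ‹_› ‹_› ((F.adj.homEquiv _ _).symm f.op)
  rw [Equiv.apply_symm_apply] at h
  rw [leftOp_homEquiv]
  exact (weakEquivalences_op_iff f).symm.trans (h.symm.trans (weakEquivalences_op_iff _).symm)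

/-- The 2-morphism between opposite Quillen adjunctions that is conjugate to a given one. -/
@[simps]
def opHom {F G : QuillenAdjunction C D} (τ : F ⟶ G) : F.op ⟶ G.op where
  natTrans := NatTrans.op (conjugateEquiv G.adj F.adj τ.natTrans)

end Opposite

section OppositeHomotopy

variable {C : Type (max u v)} [Category.{v} C] [ModelCategory C]
  {D : Type (max u v)} [Category.{v} D] [ModelCategory D]

/-- Cofibrant objects of `Dᵒᵖ` are fibrant objects of `D`, where the conjugate of `τ` is a weak
equivalence. -/
lemma IsQuillenHomotopy.op {F G : QuillenAdjunction C D} {τ : F ⟶ G} (hτ : IsQuillenHomotopy τ) :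
    IsQuillenHomotopy (opHom τ) := by
  intro Y _
  have := isFibrant_unop Y
  have := weakEquivalence_conjugateEquiv_app hτ Y.unop
  exact inferInstanceAs (WeakEquivalence ((conjugateEquiv G.adj F.adj τ.natTrans).app Y.unop).op)

end OppositeHomotopy

end QuillenAdjunction

/-! ### Equivalences in a bicategory reflect invertible 2-morphisms -/

namespace CategoryTheory.Bicategory

variable {B : Type*} [Bicategory B] {a b c : B}

/-- Whiskering again with `e.inv` and conjugating by the counit and the unitors recovers `η`. -/
lemma Equivalence.isIso_of_isIso_whiskerLeft (e : a ≌ b) {f g : b ⟶ c} (η : f ⟶ g)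
    [IsIso (e.hom ◁ η)] : IsIso η := by
  have h₁ : IsIso ((e.inv ≫ e.hom) ◁ η) := by
    rw [comp_whiskerLeft]
    infer_instance
  have h₂ : 𝟙 b ◁ η = e.counit.inv ▷ f ≫ (e.inv ≫ e.hom) ◁ η ≫ e.counit.hom ▷ g := by
    rw [whisker_exchange, inv_hom_whiskerRight_assoc]
  have h₃ : η = (λ_ f).inv ≫ 𝟙 b ◁ η ≫ (λ_ g).hom := by simp
  rw [h₃, h₂]
  infer_instance

lemma Equivalence.isIso_of_isIso_whiskerRight (e : b ≌ c) {f g : a ⟶ b} (η : f ⟶ g)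
    [IsIso (η ▷ e.hom)] : IsIso η := by
  have h₁ : IsIso (η ▷ (e.hom ≫ e.inv)) := by
    rw [whiskerRight_comp]
    infer_instance
  have h₂ : η ▷ 𝟙 b = f ◁ e.unit.hom ≫ η ▷ (e.hom ≫ e.inv) ≫ g ◁ e.unit.inv := by
    rw [whisker_exchange_assoc, whiskerLeft_hom_inv, Category.comp_id]
  have h₃ : η = (ρ_ f).inv ≫ η ▷ 𝟙 b ≫ (ρ_ g).hom := by simp
  rw [h₃, h₂]
  infer_instance

end CategoryTheory.Bicategory

namespace CategoryTheory.Pseudofunctor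

open CategoryTheory.Bicategory

variable {A : Type*} [Bicategory A] {B : Type*} [Bicategory B] (Φ : Pseudofunctor A B)
  {a b c : A}

lemma isIso_map₂_of_isIso_whiskerLeft {s : a ⟶ b} (hs : IsEquivalenceOneCell (Φ.map s))
    {f g : b ⟶ c} (η : f ⟶ g) [IsIso (s ◁ η)] : IsIso (Φ.map₂ η) := by
  obtain ⟨e, he⟩ := hs
  have h : Φ.map s ◁ Φ.map₂ η = (Φ.mapComp s f).inv ≫ Φ.map₂ (s ◁ η) ≫ (Φ.mapComp s g).hom := by
    simp
  have : IsIso (Φ.map s ◁ Φ.map₂ η) := by rw [h]; infer_instance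
  rw [← he] at this
  exact e.isIso_of_isIso_whiskerLeft _

lemma isIso_map₂_of_isIso_whiskerRight {s : b ⟶ c} (hs : IsEquivalenceOneCell (Φ.map s))
    {f g : a ⟶ b} (η : f ⟶ g) [IsIso (η ▷ s)] : IsIso (Φ.map₂ η) := by
  obtain ⟨e, he⟩ := hs
  have h : Φ.map₂ η ▷ Φ.map s = (Φ.mapComp f s).inv ≫ Φ.map₂ (η ▷ s) ≫ (Φ.mapComp g s).hom := by
    simp
  have : IsIso (Φ.map₂ η ▷ Φ.map s) := by rw [h]; infer_instance
  rw [← he] at this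
  exact e.isIso_of_isIso_whiskerRight _

/-- A 2-morphism that factors through `T`, as a whiskering of a 2-morphism `δ` that becomes
invertible after restriction along `s`, is sent to an isomorphism if `s` is sent to an
equivalence. -/
lemma isIso_map₂_of_eq_whiskerLeft {m p n : A} {F G : m ⟶ n} {T : m ⟶ p} {f g : p ⟶ n}
    {δ : f ⟶ g} {s : n ⟶ p} {τ : F ⟶ G} (α : F ≅ T ≫ f) (β : G ≅ T ≫ g)
    (h : τ = α.hom ≫ T ◁ δ ≫ β.inv) (hs : IsEquivalenceOneCell (Φ.map s)) [IsIso (s ◁ δ)] :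
    IsIso (Φ.map₂ τ) := by
  have := Φ.isIso_map₂_of_isIso_whiskerLeft hs δ
  rw [h, Φ.map₂_comp, Φ.map₂_comp, Φ.map₂_whisker_left]
  infer_instance

/-- The mirror image, for the cylinder: here `T` comes after `δ`. -/
lemma isIso_map₂_of_eq_whiskerRight {m p n : A} {F G : m ⟶ n} {T : p ⟶ n} {f g : m ⟶ p}
    {δ : f ⟶ g} {s : p ⟶ m} {τ : F ⟶ G} (α : F ≅ f ≫ T) (β : G ≅ g ≫ T)
    (h : τ = α.hom ≫ δ ▷ T ≫ β.inv) (hs : IsEquivalenceOneCell (Φ.map s)) [IsIso (δ ▷ s)] :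
    IsIso (Φ.map₂ τ) := by
  have := Φ.isIso_map₂_of_isIso_whiskerRight hs δ
  rw [h, Φ.map₂_comp, Φ.map₂_comp, Φ.map₂_whisker_right]
  infer_instance

end CategoryTheory.Pseudofunctor

/-! ### Invertible 2-morphisms, and conjugation in the opposite -/

namespace QuillenAdjunction

variable {C : Type u} [Category.{v} C] [ModelCategory C]
  {D : Type u} [Category.{v} D] [ModelCategory D]

lemma isIso_of_app {F G : QuillenAdjunction C D} (τ : F ⟶ G)
    (h : ∀ X, IsIso (τ.natTrans.app X)) : IsIso τ := by
  have := NatIso.isIso_of_isIso_app τ.natTrans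
  exact ⟨⟨inv τ.natTrans⟩, trans_ext (IsIso.hom_inv_id _), trans_ext (IsIso.inv_hom_id _)⟩

end QuillenAdjunction

lemma ModQ.FullSub.isIso_of_hom {P : ModQ.{v, u} → Prop} {M N : ModQ.FullSub P} {F G : M ⟶ N}
    (τ : F ⟶ G) (h : IsIso τ.hom) : IsIso τ :=
  (Bicategory.InducedBicategory.isoMk (asIso τ.hom)).isIso_hom

/-- Conjugating twice gives back `τ`; this recovers `τ` from the homotopy of opposites. -/
lemma CategoryTheory.conjugateEquiv_op {C D : Type*} [Category* C] [Category* D] {F G : C ⥤ D}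
    {F' G' : D ⥤ C} (adjF : F ⊣ F') (adjG : G ⊣ G') (τ : F ⟶ G) :
    conjugateEquiv adjG.op adjF.op (NatTrans.op (conjugateEquiv adjG adjF τ)) =
      NatTrans.op τ := by
  ext X
  apply Quiver.Hom.unop_inj
  apply (adjF.homEquiv X.unop _).injective
  have h := adjF.homEquiv_comp_conjugateEquiv_app adjG τ (𝟙 (G.obj X.unop))
  rw [Category.comp_id, Adjunction.homEquiv_id] at h
  refine Eq.trans ?_ h
  rw [← Equiv.eq_symm_apply, Adjunction.homEquiv_counit]
  simp

/-! ### The factorization through the path model, and its dual -/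

namespace QuillenAdjunction

section Path

attribute [local instance] PathModel.modelCategory

variable {C : Type (max u v)} [Category.{v} C] [ModelCategory C]
  {D : Type (max u v)} [Category.{v} D] [ModelCategory D]
  {F G : QuillenAdjunction C D} {τ : F ⟶ G}

/-- A Quillen homotopy factors through the path model: the source. -/
noncomputable def toPathSource (hτ : IsQuillenHomotopy τ) :
    F ≅ (toPath hτ).comp (pathSource D) :=
  isoMk (NatIso.ofComponents (fun X => Iso.refl (F.left.obj X)) (fun f => by
    exact (Category.comp_id _).trans (Category.id_comp _).symm))

/-- A Quillen homotopy factors through the path model: the target. -/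
noncomputable def toPathTarget (hτ : IsQuillenHomotopy τ) :
    G ≅ (toPath hτ).comp (pathTarget D) :=
  isoMk (NatIso.ofComponents (fun X => Iso.refl (G.left.obj X)) (fun f => by
    exact (Category.comp_id _).trans (Category.id_comp _).symm))

lemma natTrans_eq_whiskerLeft_pathProj (hτ : IsQuillenHomotopy τ) :
    τ.natTrans = (toPathSource hτ).hom.natTrans ≫
      Functor.whiskerLeft (toPath hτ).left (pathProj D).natTrans ≫
        (toPathTarget hτ).inv.natTrans := by
  ext X
  exact ((Category.id_comp _).trans (Category.comp_id _)).symm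

/-- On right adjoints the projection 2-morphism is the map from `𝟙 Y` to `Y ⟶ ⊤`. The right adjoint
of the constant path reads off level `0`, which makes it invertible. -/
lemma conjugateEquiv_pathProj_app_left (Y : D) :
    ((conjugateEquiv (pathTarget D).adj (pathSource D).adj (pathProj D).natTrans).app Y).left =
      𝟙 Y := by
  have h := (pathSource D).adj.homEquiv_comp_conjugateEquiv_app (pathTarget D).adj
    (pathProj D).natTrans (X := Arrow.mk (𝟙 Y)) (Y := Y) (𝟙 Y)
  have h₁ : (pathTarget D).adj.homEquiv (Arrow.mk (𝟙 Y)) Y (𝟙 Y) = 𝟙 (Arrow.mk (𝟙 Y)) := by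
    simp only [pathTarget, Adjunction.mkOfHomEquiv_homEquiv]
    exact Arrow.hom_ext _ _ (Category.comp_id _) rfl
  have h₂ : ((pathSource D).adj.homEquiv (Arrow.mk (𝟙 Y)) Y
      ((pathProj D).natTrans.app (Arrow.mk (𝟙 Y)) ≫ 𝟙 Y)).left = 𝟙 Y := by
    simp only [pathSource, Adjunction.mkOfHomEquiv_homEquiv]
    exact Category.comp_id _
  rw [h₁] at h
  exact (Category.id_comp _).symm.trans ((congrArg Arrow.Hom.left h).trans h₂)

end Path

section Opposite

variable {C : Type u} [Category.{v} C] [ModelCategory C]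
  {D : Type u} [Category.{v} D] [ModelCategory D]
  {E : Type u} [Category.{v} E] [ModelCategory E]

/-- The right adjoints of isomorphic Quillen adjunctions are isomorphic. -/
noncomputable def rightIso {F G : QuillenAdjunction C D} (e : F ≅ G) : G.right ≅ F.right where
  hom := conjugateEquiv G.adj F.adj e.hom.natTrans
  inv := conjugateEquiv F.adj G.adj e.inv.natTrans
  hom_inv_id := by
    rw [conjugateEquiv_comp, ← conjugateEquiv_id]
    exact congrArg _ (congrArg Trans.natTrans e.inv_hom_id)
  inv_hom_id := by
    rw [conjugateEquiv_comp, ← conjugateEquiv_id]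
    exact congrArg _ (congrArg Trans.natTrans e.hom_inv_id)

/-- The 2-morphism between opposite Quillen adjunctions that is conjugate to a given one. -/
@[simps]
def rightOpHom {S₀ S₁ : QuillenAdjunction E Cᵒᵖ} (δ : S₀ ⟶ S₁) : S₀.rightOp ⟶ S₁.rightOp where
  natTrans := NatTrans.rightOp (conjugateEquiv S₁.adj S₀.adj δ.natTrans)

/-- A factorization of the opposite of `F` gives a factorization of `F`. -/
noncomputable def isoRightOpCompLeftOp {F : QuillenAdjunction C D} {T : QuillenAdjunction Dᵒᵖ E}
    {S : QuillenAdjunction E Cᵒᵖ} (e : F.op ≅ T.comp S) : F ≅ S.rightOp.comp T.leftOp :=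
  isoMk (NatIso.ofComponents (fun X => ((rightIso e).app (.op X)).unop) (fun f =>
    Quiver.Hom.op_inj ((rightIso e).hom.naturality f.op).symm))

/-- Conjugation reverses composition, turns left whiskering with `T` into right whiskering with its
right adjoint, and takes `opHom τ` back to `τ`. -/
lemma natTrans_eq_whiskerRight_of_op {F G : QuillenAdjunction C D} {τ : F ⟶ G}
    {T : QuillenAdjunction Dᵒᵖ E} {S₀ S₁ : QuillenAdjunction E Cᵒᵖ} {δ : S₀ ⟶ S₁}
    (e₀ : F.op ≅ T.comp S₀) (e₁ : G.op ≅ T.comp S₁)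
    (h : (opHom τ).natTrans = e₀.hom.natTrans ≫
      Functor.whiskerLeft T.left δ.natTrans ≫ e₁.inv.natTrans) :
    τ.natTrans = (isoRightOpCompLeftOp e₀).hom.natTrans ≫
      Functor.whiskerRight (rightOpHom δ).natTrans T.leftOp.left ≫
        (isoRightOpCompLeftOp e₁).inv.natTrans := by
  let ω : T.comp S₀ ⟶ T.comp S₁ := ⟨Functor.whiskerLeft T.left δ.natTrans⟩
  change _ = e₀.hom.natTrans ≫ ω.natTrans ≫ e₁.inv.natTrans at h
  replace h := congrArg (conjugateEquiv G.op.adj F.op.adj) h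
  rw [← conjugateEquiv_comp _ (T.comp S₀).adj, ← conjugateEquiv_comp _ (T.comp S₁).adj] at h
  have h₁ : conjugateEquiv (T.comp S₁).adj (T.comp S₀).adj ω.natTrans =
      Functor.whiskerRight (conjugateEquiv S₁.adj S₀.adj δ.natTrans) T.right :=
    conjugateEquiv_whiskerLeft _ _ _ _
  have h₂ : conjugateEquiv G.op.adj F.op.adj (opHom τ).natTrans = NatTrans.op τ.natTrans :=
    conjugateEquiv_op F.adj G.adj τ.natTrans
  rw [h₁, h₂] at h
  ext X
  exact congrArg Quiver.Hom.unop (NatTrans.congr_app h (.op X))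

end Opposite

end QuillenAdjunction

/-! ### The bicategorical argument in a full sub-2-category -/

namespace ModQ

open QuillenAdjunction

variable {P : ModQ.{v, u} → Prop} {B : Type u₂} [Bicategory.{w₂, v₂} B]
  (Φ : Pseudofunctor (FullSub P) B)
  (hΦ : ∀ {K L : FullSub P} (F : K ⟶ L), F.hom.IsQuillenEquivalence →
    IsEquivalenceOneCell (Φ.map F))
  {M N : FullSub P} {F G : M ⟶ N} (τ : F ⟶ G)

include hΦ

/-- By fullness, only the intermediate object `K` has to satisfy `P`; all 1- and 2-morphisms of the
factorization then lie in the sub-2-category. -/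
lemma isIso_map₂_of_eq_whiskerLeft {K : ModQ.{v, u}} (hK : P K)
    {T : QuillenAdjunction M.1.carrier K.carrier} {d₀ d₁ : QuillenAdjunction K.carrier N.1.carrier}
    {δ : d₀ ⟶ d₁} {s : QuillenAdjunction N.1.carrier K.carrier}
    (α : F.hom ≅ QuillenAdjunction.comp T d₀) (β : G.hom ≅ QuillenAdjunction.comp T d₁)
    (h : τ.hom.natTrans = α.hom.natTrans ≫ Functor.whiskerLeft T.left δ.natTrans ≫ β.inv.natTrans)
    (hs : s.IsQuillenEquivalence) (hδ : ∀ X, IsIso (δ.natTrans.app (s.left.obj X))) :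
    IsIso (Φ.map₂ τ) := by
  let K' : FullSub P := ⟨K, hK⟩
  let T' : M ⟶ K' := Bicategory.InducedBicategory.mkHom T
  let δ' : (Bicategory.InducedBicategory.mkHom d₀ : K' ⟶ N) ⟶
    Bicategory.InducedBicategory.mkHom d₁ := ⟨δ⟩
  let s' : N ⟶ K' := Bicategory.InducedBicategory.mkHom s
  have : IsIso (Bicategory.whiskerLeft s' δ') := FullSub.isIso_of_hom _ (isIso_of_app _ hδ)
  exact Φ.isIso_map₂_of_eq_whiskerLeft (T := T') (δ := δ') (s := s')
    (Bicategory.InducedBicategory.isoMk α) (Bicategory.InducedBicategory.isoMk β)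
    (Bicategory.InducedBicategory.hom₂_ext (trans_ext h)) (hΦ s' hs)

lemma isIso_map₂_of_eq_whiskerRight {K : ModQ.{v, u}} (hK : P K)
    {T : QuillenAdjunction K.carrier N.1.carrier} {d₀ d₁ : QuillenAdjunction M.1.carrier K.carrier}
    {δ : d₀ ⟶ d₁} {s : QuillenAdjunction K.carrier M.1.carrier}
    (α : F.hom ≅ QuillenAdjunction.comp d₀ T) (β : G.hom ≅ QuillenAdjunction.comp d₁ T)
    (h : τ.hom.natTrans = α.hom.natTrans ≫ Functor.whiskerRight δ.natTrans T.left ≫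
      β.inv.natTrans)
    (hs : s.IsQuillenEquivalence) (hδ : ∀ X, IsIso (s.left.map (δ.natTrans.app X))) :
    IsIso (Φ.map₂ τ) := by
  let K' : FullSub P := ⟨K, hK⟩
  let T' : K' ⟶ N := Bicategory.InducedBicategory.mkHom T
  let δ' : (Bicategory.InducedBicategory.mkHom d₀ : M ⟶ K') ⟶
    Bicategory.InducedBicategory.mkHom d₁ := ⟨δ⟩
  let s' : K' ⟶ M := Bicategory.InducedBicategory.mkHom s
  have : IsIso (Bicategory.whiskerRight δ' s') := FullSub.isIso_of_hom _ (isIso_of_app _ hδ)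
  exact Φ.isIso_map₂_of_eq_whiskerRight (T := T') (δ := δ') (s := s')
    (Bicategory.InducedBicategory.isoMk α) (Bicategory.InducedBicategory.isoMk β)
    (Bicategory.InducedBicategory.hom₂_ext (trans_ext h)) (hΦ s' hs)

end ModQ

namespace QuillenAdjunction

section

attribute [local instance] PathModel.modelCategory

lemma isIso_leftOp_map_rightOpHom_pathProj (C : Type (max u v)) [Category.{v} C]
    [ModelCategory C] (X : C) :
    IsIso ((pathConst Cᵒᵖ).leftOp.left.map ((rightOpHom (pathProj Cᵒᵖ)).natTrans.app X)) := by
  have h : IsIso ((conjugateEquiv (pathTarget Cᵒᵖ).adj (pathSource Cᵒᵖ).adj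
      (pathProj Cᵒᵖ).natTrans).app (.op X)).left := by
    rw [conjugateEquiv_pathProj_app_left]
    exact inferInstanceAs (IsIso (𝟙 _))
  exact inferInstanceAs (IsIso ((conjugateEquiv (pathTarget Cᵒᵖ).adj
    (pathSource Cᵒᵖ).adj (pathProj Cᵒᵖ).natTrans).app (.op X)).left.unop)

end

end QuillenAdjunction

/-! ### The path and cylinder cases -/

namespace ModQ

open QuillenAdjunction

attribute [local instance] PathModel.modelCategory

variable {P : ModQ.{v, max u v} → Prop} {B : Type u₂} [Bicategory.{w₂, v₂} B]
  (Φ : Pseudofunctor (FullSub P) B)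
  (hΦ : ∀ {K L : FullSub P} (F : K ⟶ L), F.hom.IsQuillenEquivalence →
    IsEquivalenceOneCell (Φ.map F))
  {M N : FullSub P} {F G : M ⟶ N} (τ : F ⟶ G) (hτ : IsQuillenHomotopy τ.hom)

include hΦ hτ

lemma isIso_map₂_of_path (hN : P N.1.path) : IsIso (Φ.map₂ τ) :=
  isIso_map₂_of_eq_whiskerLeft Φ hΦ τ hN (toPathSource hτ) (toPathTarget hτ)
    (natTrans_eq_whiskerLeft_pathProj hτ) (isQuillenEquivalence_pathConst N.1.carrier)
    -- A constant path has equal source and target, and the projection 2-morphism is the identity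
    -- there.
    (fun X => inferInstanceAs (IsIso (𝟙 (X : N.1.carrier))))

/-- The opposite homotopy factors through `Ch(Mᵒᵖ)`. Dually, `τ` is a 2-morphism between two
1-morphisms `M ⟶ Cyl(M)`, followed by a single `Cyl(M) ⟶ N`; the dual of the constant path is
`Cyl(M) ⟶ M`. -/
lemma isIso_map₂_of_cyl (hM : P M.1.cyl) : IsIso (Φ.map₂ τ) :=
  isIso_map₂_of_eq_whiskerRight Φ hΦ τ hM (s := (pathConst M.1.carrierᵒᵖ).leftOp)
    (isoRightOpCompLeftOp (toPathSource hτ.op))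
    (isoRightOpCompLeftOp (toPathTarget hτ.op))
    (natTrans_eq_whiskerRight_of_op _ _ (natTrans_eq_whiskerLeft_pathProj hτ.op))
    (isQuillenEquivalence_pathConst M.1.carrierᵒᵖ).leftOp
    (isIso_leftOp_map_rightOpHom_pathProj M.1.carrier)

end ModQ

/-- With objects in universe `max u v`, the path and cylinder models stay in the same 2-category. -/
theorem mainTheorem12
    (P : ModQ.{v, max u v} → Prop) {B : Type u₂} [Bicategory.{w₂, v₂} B]
    (Φ : Pseudofunctor (ModQ.FullSub P) B)
    (hΦ : ∀ {K L : ModQ.FullSub P} (F : K ⟶ L), F.hom.IsQuillenEquivalence →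
      IsEquivalenceOneCell (Φ.map F))
    (M N : ModQ.FullSub P) (hMN : P M.1.cyl ∨ P N.1.path)
    {F G : M ⟶ N} (τ : F ⟶ G) (hτ : QuillenAdjunction.IsQuillenHomotopy τ.hom) :
    IsIso (Φ.map₂ τ) :=
  hMN.elim (ModQ.isIso_map₂_of_cyl Φ hΦ τ hτ) (ModQ.isIso_map₂_of_path Φ hΦ τ hτ)
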